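/- **Conventions.** A simplicial complex is a (possibly infinite, possibly empty) set of nonempty finite subsets of a vertex set, closed under passing to nonempty subsets; its simplices are oriented by a chosen total order of the vertices, which fixes the incidence numbers $[\sigma:\tau]\in\{0,\pm1\}$ (nonzero exactly when $\sigma$ is a codimension-one face of $\tau$). Fix an abelian group $G$; $H_n(-)$ denotes (non-reduced) simplicial, respectively cellular, homology with coefficients in $G$. Let $K, M$ be simplicial complexes and let $\tilde R\subseteq K\times M$ be a relation between them, closed under faces: if $\sigma\,\tilde R\,\tau$, $\sigma'\subseteq\sigma$ and $\tau'\subseteq\tau$ with $\sigma'\in K$, $\tau'\in M$, then $\sigma'\,\tilde R\,\tau'$. The *relational product complex* $K\times_{\tilde R}M=\bigcup_{\sigma\tilde R\tau}\sigma\times\tau$ is the regular CW complex whose cells are the products $\sigma\times\tau$ with $\sigma\,\tilde R\,\tau$, with $\dim(\sigma\times\tau)=\dim\sigma+\dim\tau$ and cellular boundary $\partial(\sigma\times\tau)=\partial\sigma\times\tau+(-1)^{\dim\sigma}\,\sigma\times\partial\tau$. A *cellular cosheaf* $\mathcal F$ on a simplicial complex $X$ is a contravariant functor from its face poset to abelian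 groups; $H_n(X,\mathcal F)$ is the homology of the complex with $C_n(X,\mathcal F)=\bigoplus_{\dim\sigma=n}\mathcal F(\sigma)$ and $\partial(s_\tau)=\sum_{\sigma\subseteq\tau}[\sigma:\tau]\,\mathcal F(\sigma\subseteq\tau)(s_\tau)$. For $\sigma\in K$ let $\mathcal F_K(\sigma)=\{\tau\in M:\sigma\,\tilde R\,\tau\}$, a subcomplex of $M$, and for $q\ge 0$ let $\mathcal F_K^q$ be the cellular cosheaf $\sigma\mapsto H_q(\mathcal F_K(\sigma))$ on $K$, with extension maps induced by the inclusions $\mathcal F_K(\tau)\subseteq\mathcal F_K(\sigma)$ for $\sigma\subseteq\tau$. Symmetrically, for $\tau\in M$ let $\mathcal F_M(\tau)=\{\sigma\in K:\sigma\,\tilde R\,\tau\}$, and for $p\ge 0$ let $\mathcal F_M^p$ be the cellular cosheaf $\tau\mapsto H_p(\mathcal F_M(\tau))$ on $M$. **Theorem.** There exist first quadrant spectral sequences of abelian groups, starting at the second page, with $$E^{K,2}_{p,q}\cong H_p(K,\mathcal F_K^q),\qquad E^{M,2}_{p,q}\cong H_q(M,\mathcal F_M^p)\qquad(p,q\ge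 0),$$ where $d^r$ has bidegree $(-r,r-1)$ in $E^K$ and $(r-1,-r)$ in $E^M$, such that $$E^{K,2}_{p,q}\Longrightarrow H_{p+q}(K\times_{\tilde R}M)\Longleftarrow E^{M,2}_{p,q}.$$ That is, for every $n\ge 0$ the group $H_n(K\times_{\tilde R}M)$ has a finite increasing filtration $0=\Phi_{-1}\subseteq\Phi_0\subseteq\dots\subseteq\Phi_n=H_n(K\times_{\tilde R}M)$ with $\Phi_p/\Phi_{p-1}\cong E^{K,\infty}_{p,n-p}$ for $0\le p\le n$, and a finite increasing filtration $0=\Psi_{-1}\subseteq\Psi_0\subseteq\dots\subseteq\Psi_n=H_n(K\times_{\tilde R}M)$ with $\Psi_q/\Psi_{q-1}\cong E^{M,\infty}_{n-q,q}$ for $0\le q\le n$. Here $E^\infty_{p,q}=E^r_{p,q}$ for any $r\ge p+q+2$. -/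

import Mathlib

open CategoryTheory CategoryTheory.Limits

universe w v u

/-- The combinatorial data of a regular cell complex whose face poset is `P`
(no empty cell): the finite set of faces of a cell, its dimension, and the incidence numbers
`inc c' c = [c' : c]`, which vanish unless `c'` is a face of codimension one of `c`. -/
structure CellStructure (P : Type u) [PartialOrder P] where
  /-- the faces of a cell (including the cell itself) -/
  faces : P → Finset P
  mem_faces : ∀ {c' c : P}, c' ∈ faces c ↔ c' ≤ c
  /-- the dimension of a cell -/
  dim : P → ℕ
  /-- the incidence number `[c' : c]` -/
  inc : P → P → ℤ
  le_of_inc : ∀ {c' c : P}, inc c' c ≠ 0 → c' ≤ c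
  dim_of_inc : ∀ {c' c : P}, inc c' c ≠ 0 → dim c = dim c' + 1
  sum_inc_mul_inc : ∀ c'' c : P, ∑ c' ∈ faces c, inc c'' c' * inc c' c = 0

namespace CellStructure

section Cosheaf

variable {P : Type u} [PartialOrder P] (S : CellStructure P)
  {C : Type w} [Category.{v} C] [Abelian C]

/-- The extension map `F(c' ≤ c) : F(c) ⟶ F(c')` of a cellular cosheaf, i.e. of a contravariant
functor on the face poset (by convention zero when `c'` is not a face of `c`). -/
noncomputable def extensionMap (F : Pᵒᵖ ⥤ C) (c c' : P) :
    F.obj (Opposite.op c) ⟶ F.obj (Opposite.op c') :=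
  open Classical in if h : c' ≤ c then F.map (homOfLE h).op else 0

theorem extensionMap_of_le (F : Pᵒᵖ ⥤ C) {c c' : P} (h : c' ≤ c) :
    extensionMap F c c' = F.map (homOfLE h).op := by
  simp [extensionMap, h]

theorem extensionMap_comp (F : Pᵒᵖ ⥤ C) {c c' c'' : P} (h : c' ≤ c) (h' : c'' ≤ c') :
    extensionMap F c c' ≫ extensionMap F c' c'' = extensionMap F c c'' := by
  rw [extensionMap_of_le F h, extensionMap_of_le F h', extensionMap_of_le F (h'.trans h),
    ← F.map_comp]
  rfl

variable [HasCoproducts.{u} C]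

/-- The `n`-chains `⨁_{dim c = n} F(c)` of a cellular cosheaf. -/
noncomputable def chains (F : Pᵒᵖ ⥤ C) (n : ℕ) : C :=
  ∐ fun c : {c : P // S.dim c = n} => F.obj (Opposite.op c.1)

/-- The inclusion of the summand `F(c)` into the `n`-chains if `dim c = n`
(by convention zero for the other cells). -/
noncomputable def ιChains (F : Pᵒᵖ ⥤ C) (n : ℕ) (c : P) :
    F.obj (Opposite.op c) ⟶ S.chains F n :=
  if h : S.dim c = n then
    Sigma.ι (fun c : {c : P // S.dim c = n} => F.obj (Opposite.op c.1)) ⟨c, h⟩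
  else 0

theorem ιChains_of_dim (F : Pᵒᵖ ⥤ C) {n : ℕ} {c : P} (h : S.dim c = n) :
    S.ιChains F n c =
      Sigma.ι (fun c : {c : P // S.dim c = n} => F.obj (Opposite.op c.1)) ⟨c, h⟩ :=
  dif_pos h

theorem ιChains_of_dim_ne (F : Pᵒᵖ ⥤ C) {n : ℕ} {c : P} (h : S.dim c ≠ n) :
    S.ιChains F n c = 0 :=
  dif_neg h

/-- The boundary map, `∂ (s_c) = ∑_{c' ≤ c} [c' : c] F(c' ≤ c) (s_c)`. -/
noncomputable def boundary (F : Pᵒᵖ ⥤ C) (n : ℕ) : S.chains F (n + 1) ⟶ S.chains F n :=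
  Sigma.desc fun c => ∑ c' ∈ S.faces c.1,
    S.inc c' c.1 • (extensionMap F c.1 c' ≫ S.ιChains F n c')

theorem chains_hom_ext {F : Pᵒᵖ ⥤ C} {n : ℕ} {A : C} {f g : S.chains F n ⟶ A}
    (h : ∀ c, S.dim c = n → S.ιChains F n c ≫ f = S.ιChains F n c ≫ g) : f = g := by
  refine Sigma.hom_ext _ _ fun c => ?_
  have := h c.1 c.2
  rw [S.ιChains_of_dim F c.2] at this
  exact this

theorem ιChains_boundary (F : Pᵒᵖ ⥤ C) (n : ℕ) (c : P) :
    S.ιChains F (n + 1) c ≫ S.boundary F n =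
      ∑ c' ∈ S.faces c, S.inc c' c • (extensionMap F c c' ≫ S.ιChains F n c') := by
  by_cases h : S.dim c = n + 1
  · rw [S.ιChains_of_dim F h]
    exact Sigma.ι_desc _ (⟨c, h⟩ : {c : P // S.dim c = n + 1})
  · rw [S.ιChains_of_dim_ne F h, zero_comp, Finset.sum_eq_zero]
    intro c' _
    by_cases h0 : S.inc c' c = 0
    · simp [h0]
    · have h1 := S.dim_of_inc h0
      have h2 : S.dim c' ≠ n := by omega
      simp [S.ιChains_of_dim_ne F h2]

theorem boundary_comp (F : Pᵒᵖ ⥤ C) (n : ℕ) :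
    S.boundary F (n + 1) ≫ S.boundary F n = 0 := by
  refine S.chains_hom_ext fun c _ => ?_
  rw [← Category.assoc, ιChains_boundary, comp_zero, Preadditive.sum_comp]
  have key : ∀ c' ∈ S.faces c,
      (S.inc c' c • (extensionMap F c c' ≫ S.ιChains F (n + 1) c')) ≫ S.boundary F n =
        ∑ c'' ∈ S.faces c, (S.inc c'' c' * S.inc c' c) •
          (extensionMap F c c'' ≫ S.ιChains F n c'') := by
    intro c' hc'
    have hle := S.mem_faces.1 hc'
    rw [Preadditive.zsmul_comp, Category.assoc, ιChains_boundary, Preadditive.comp_sum,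
      Finset.smul_sum]
    have hsub : S.faces c' ⊆ S.faces c := fun x hx =>
      S.mem_faces.2 ((S.mem_faces.1 hx).trans hle)
    rw [← Finset.sum_subset hsub]
    · refine Finset.sum_congr rfl fun c'' hc'' => ?_
      rw [Preadditive.comp_zsmul, ← Category.assoc,
        extensionMap_comp F hle (S.mem_faces.1 hc''), smul_smul, mul_comm]
    · intro c'' _ hn
      have : S.inc c'' c' = 0 := by
        by_contra h0
        exact hn (S.mem_faces.2 (S.le_of_inc h0))
      simp [this]
  rw [Finset.sum_congr rfl key, Finset.sum_comm]
  refine Finset.sum_eq_zero fun c'' _ => ?_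
  rw [← Finset.sum_smul, S.sum_inc_mul_inc, zero_smul]

/-- The cellular chain complex of a cellular cosheaf. -/
noncomputable def chainComplex (F : Pᵒᵖ ⥤ C) : ChainComplex C ℕ :=
  ChainComplex.of (S.chains F) (S.boundary F) (S.boundary_comp F)

theorem chainComplex_d (F : Pᵒᵖ ⥤ C) (n : ℕ) :
    (S.chainComplex F).d (n + 1) n = S.boundary F n :=
  ChainComplex.of_d ..

/-- The homology `H_n(P; F)` of a cellular cosheaf `F`. -/
noncomputable def cosheafHomology (F : Pᵒᵖ ⥤ C) (n : ℕ) : C :=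
  (S.chainComplex F).homology n

end Cosheaf

section Constructions

variable {P : Type u} [PartialOrder P] (S : CellStructure P)

/-- The cell structure of a subcomplex, i.e. of a set of cells closed under taking faces. -/
noncomputable def restrict (L : LowerSet P) : CellStructure L where
  faces c := open Classical in (S.faces c.1).subtype (· ∈ L)
  mem_faces := by
    intro c' c
    simp [S.mem_faces]
  dim c := S.dim c.1
  inc c' c := S.inc c'.1 c.1
  le_of_inc h := S.le_of_inc h
  dim_of_inc h := S.dim_of_inc h
  sum_inc_mul_inc c'' c := by
    classical
    rw [← S.sum_inc_mul_inc c''.1 c.1]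
    refine Finset.sum_bij_ne_zero (fun c' _ _ => c'.1) ?_ ?_ ?_ ?_
    · intro a ha _
      simpa using ha
    · intro a _ _ b _ _ h
      exact Subtype.ext h
    · intro b hb _
      exact ⟨⟨b, L.lower (S.mem_faces.1 hb) c.2⟩, by simpa using hb, by assumption, rfl⟩
    · intros
      rfl

/-- The product of two cell structures: the cells are the products `σ × τ`, of dimension
`dim σ + dim τ`, and `∂ (σ × τ) = ∂ σ × τ + (-1) ^ dim σ • σ × ∂ τ`. -/
noncomputable def prod {Q : Type u} [PartialOrder Q] (T : CellStructure Q) :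
    CellStructure (P × Q) where
  faces c := S.faces c.1 ×ˢ T.faces c.2
  mem_faces := by
    intro c' c
    simp [S.mem_faces, T.mem_faces, Prod.le_def]
  dim c := S.dim c.1 + T.dim c.2
  inc c' c := open Classical in
    (if c'.2 = c.2 then S.inc c'.1 c.1 else 0) +
      (if c'.1 = c.1 then (-1) ^ S.dim c.1 * T.inc c'.2 c.2 else 0)
  le_of_inc := by
    rintro ⟨a', b'⟩ ⟨a, b⟩ h
    rw [Prod.le_def]
    dsimp only at h ⊢
    split_ifs at h with h1 h2 h2
    · exact ⟨h2.le, h1.le⟩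
    · exact ⟨S.le_of_inc (by simpa using h), h1.le⟩
    · exact ⟨h2.le, T.le_of_inc (by simpa using h)⟩
    · simp at h
  dim_of_inc := by
    rintro ⟨a', b'⟩ ⟨a, b⟩ h
    have hS : S.inc a a = 0 := by
      by_contra h0
      have := S.dim_of_inc h0
      omega
    have hT : T.inc b b = 0 := by
      by_contra h0
      have := T.dim_of_inc h0
      omega
    dsimp only at h ⊢
    split_ifs at h with h1 h2 h2
    · subst h1 h2
      simp [hS, hT] at h
    · subst h1
      have := S.dim_of_inc (c' := a') (c := a) (by simpa using h)
      omega
    · subst h2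
      have := T.dim_of_inc (c' := b') (c := b) (by simpa using h)
      omega
    · simp at h
  sum_inc_mul_inc := by
    classical
    rintro ⟨a'', b''⟩ ⟨a, b⟩
    have haa : a ∈ S.faces a := S.mem_faces.2 le_rfl
    have hbb : b ∈ T.faces b := T.mem_faces.2 le_rfl
    have hS := S.sum_inc_mul_inc a'' a
    have hT := T.sum_inc_mul_inc b'' b
    rw [Finset.sum_product]
    dsimp only
    simp only [add_mul, mul_add, Finset.sum_add_distrib]
    have h11 : ∑ x ∈ S.faces a, ∑ y ∈ T.faces b,
        (if b'' = y then S.inc a'' x else 0) * (if y = b then S.inc x a else 0) = 0 := by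
      by_cases h : b'' = b
      · subst h
        refine Eq.trans (Finset.sum_congr rfl fun x _ => ?_) hS
        rw [Finset.sum_eq_single b'']
        · simp
        · intro y _ hy
          simp [hy]
        · exact fun h => absurd hbb h
      · refine Finset.sum_eq_zero fun x _ => Finset.sum_eq_zero fun y _ => ?_
        by_cases h1 : b'' = y
        · subst h1
          simp [h]
        · simp [h1]
    have h22 : ∑ x ∈ S.faces a, ∑ y ∈ T.faces b,
        (if a'' = x then (-1) ^ S.dim x * T.inc b'' y else 0) *
          (if x = a then (-1) ^ S.dim a * T.inc y b else 0) = 0 := by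
      rw [Finset.sum_eq_single a]
      · by_cases h : a'' = a
        · have : ∀ y, ((-1 : ℤ) ^ S.dim a * T.inc b'' y) * ((-1) ^ S.dim a * T.inc y b) =
              T.inc b'' y * T.inc y b := by
            intro y
            have h1 : ((-1 : ℤ) ^ S.dim a) * (-1) ^ S.dim a = 1 := by
              rw [← mul_pow]
              simp
            linear_combination (T.inc b'' y * T.inc y b) * h1
          simp only [h, if_true, this, hT]
        · simp [h]
      · intro x _ hx
        simp [hx]
      · exact fun h => absurd haa h
    have h12 : ∑ x ∈ S.faces a, ∑ y ∈ T.faces b,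
        (if b'' = y then S.inc a'' x else 0) *
          (if x = a then (-1) ^ S.dim a * T.inc y b else 0) =
        S.inc a'' a * ((-1) ^ S.dim a * T.inc b'' b) := by
      rw [Finset.sum_eq_single a]
      · rw [Finset.sum_eq_single b'']
        · simp
        · intro y _ hy
          simp [Ne.symm hy]
        · intro h
          have : T.inc b'' b = 0 := by
            by_contra h0
            exact h (T.mem_faces.2 (T.le_of_inc h0))
          simp [this]
      · intro x _ hx
        simp [hx]
      · exact fun h => absurd haa h
    have h21 : ∑ x ∈ S.faces a, ∑ y ∈ T.faces b,
        (if a'' = x then (-1) ^ S.dim x * T.inc b'' y else 0) *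
          (if y = b then S.inc x a else 0) =
        S.inc a'' a * ((-1) ^ S.dim a'' * T.inc b'' b) := by
      rw [Finset.sum_eq_single a'']
      · rw [Finset.sum_eq_single b]
        · simp only [if_true]
          ring
        · intro y _ hy
          simp [hy]
        · exact fun h => absurd hbb h
      · intro x _ hx
        simp [Ne.symm hx]
      · intro h
        have : S.inc a'' a = 0 := by
          by_contra h0
          exact h (S.mem_faces.2 (S.le_of_inc h0))
        simp [this]
    rw [h11, h22, h12, h21]
    by_cases h0 : S.inc a'' a = 0
    · simp [h0]
    · rw [S.dim_of_inc h0, pow_succ]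
      ring

section Subcomplex

variable {C : Type w} [Category.{v} C] [Abelian C] [HasCoproducts.{u} C]

/-- The cellular chain complex of the subcomplex `L` with constant coefficients `G`. -/
noncomputable def constChains (G : C) (L : LowerSet P) : ChainComplex C ℕ :=
  (S.restrict L).chainComplex ((Functor.const (↥L)ᵒᵖ).obj G)

/-- The map on `n`-chains induced by an inclusion `L ≤ L'` of subcomplexes: the summand `G` of a
cell of `L` is mapped identically to the summand `G` of the same cell of `L'`. -/
noncomputable def constChainsMapX (G : C) {L L' : LowerSet P} (h : L ≤ L') (n : ℕ) :
    (S.restrict L).chains ((Functor.const (↥L)ᵒᵖ).obj G) n ⟶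
      (S.restrict L').chains ((Functor.const (↥L')ᵒᵖ).obj G) n :=
  Sigma.desc fun c : {c : ↥L // (S.restrict L).dim c = n} =>
    (S.restrict L').ιChains ((Functor.const (↥L')ᵒᵖ).obj G) n ⟨c.1.1, h c.1.2⟩

theorem ι_constChainsMapX (G : C) {L L' : LowerSet P} (h : L ≤ L') (n : ℕ) (c : L) :
    (S.restrict L).ιChains ((Functor.const (↥L)ᵒᵖ).obj G) n c ≫ S.constChainsMapX G h n =
      (S.restrict L').ιChains ((Functor.const (↥L')ᵒᵖ).obj G) n ⟨c.1, h c.2⟩ := by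
  by_cases hc : (S.restrict L).dim c = n
  · rw [ιChains_of_dim _ _ hc]
    exact Sigma.ι_desc _ (⟨c, hc⟩ : {c : ↥L // (S.restrict L).dim c = n})
  · rw [ιChains_of_dim_ne _ _ hc, zero_comp]
    have hc' : (S.restrict L').dim ⟨c.1, h c.2⟩ ≠ n := hc
    exact (ιChains_of_dim_ne (S.restrict L') ((Functor.const (↥L')ᵒᵖ).obj G) hc').symm

theorem constChainsMapX_comm (G : C) {L L' : LowerSet P} (h : L ≤ L') (n : ℕ) :
    S.constChainsMapX G h (n + 1) ≫ (S.restrict L').boundary _ n =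
      (S.restrict L).boundary _ n ≫ S.constChainsMapX G h n := by
  classical
  refine chains_hom_ext _ fun c _ => ?_
  rw [← Category.assoc, ι_constChainsMapX, ← Category.assoc, ιChains_boundary,
    ιChains_boundary, Preadditive.sum_comp]
  symm
  refine Finset.sum_bij_ne_zero (fun c' _ _ => ⟨c'.1, h c'.2⟩) ?_ ?_ ?_ ?_
  · intro c' hc' _
    rw [mem_faces] at hc' ⊢
    exact hc'
  · intro a _ _ b _ _ hab
    exact Subtype.ext (Subtype.mk.inj hab)
  · intro b hb hb0
    rw [mem_faces] at hb
    have hbL : b.1 ∈ L := L.lower hb c.2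
    have hle : (⟨b.1, hbL⟩ : L) ≤ c := hb
    refine ⟨⟨b.1, hbL⟩, (mem_faces _).2 hle, ?_, rfl⟩
    rw [Preadditive.zsmul_comp, Category.assoc, ι_constChainsMapX, extensionMap_of_le _ hle]
    rw [extensionMap_of_le _ hb] at hb0
    exact hb0
  · intro c' hc' _
    rw [mem_faces] at hc'
    have hle : (⟨c'.1, h c'.2⟩ : L') ≤ ⟨c.1, h c.2⟩ := hc'
    rw [Preadditive.zsmul_comp, Category.assoc, ι_constChainsMapX, extensionMap_of_le _ hc',
      extensionMap_of_le _ hle]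
    rfl

/-- The chain map induced by an inclusion `L ≤ L'` of subcomplexes. -/
noncomputable def constChainsMap (G : C) {L L' : LowerSet P} (h : L ≤ L') :
    S.constChains G L ⟶ S.constChains G L' :=
  ChainComplex.ofHom (X := S.constChains G L) (Y := S.constChains G L')
    (fun n => S.constChainsMapX G h n) (fun n => by
      have h1 := (S.restrict L).chainComplex_d ((Functor.const (↥L)ᵒᵖ).obj G) n
      have h2 := (S.restrict L').chainComplex_d ((Functor.const (↥L')ᵒᵖ).obj G) n
      simp only [constChains, h1, h2]
      exact S.constChainsMapX_comm G h n)

/-- The functor sending a subcomplex `L` to its cellular chain complex with coefficients `G`. -/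
noncomputable def constChainsFunctor (G : C) : LowerSet P ⥤ ChainComplex C ℕ where
  obj := S.constChains G
  map f := S.constChainsMap G (leOfHom f)
  map_id L := by
    ext n : 1
    refine chains_hom_ext _ fun c _ => ?_
    exact (S.ι_constChainsMapX G le_rfl n c).trans (Category.comp_id _).symm
  map_comp {L L' L''} f g := by
    ext n : 1
    refine chains_hom_ext _ fun c _ => ?_
    have h1 := S.ι_constChainsMapX G (leOfHom f) n c
    have h2 := S.ι_constChainsMapX G (leOfHom g) n ⟨c.1, leOfHom f c.2⟩
    refine (S.ι_constChainsMapX G (leOfHom (f ≫ g)) n c).trans ?_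
    refine Eq.trans ?_ (Category.assoc _ _ _)
    refine Eq.trans h2.symm ?_
    exact congrArg (· ≫ S.constChainsMapX G (leOfHom g) n) h1.symm

/-- The functor sending a subcomplex `L` to its cellular homology `H_n(L; G)`. -/
noncomputable def subcomplexHomology (G : C) (n : ℕ) : LowerSet P ⥤ C :=
  S.constChainsFunctor G ⋙ HomologicalComplex.homologyFunctor C (ComplexShape.down ℕ) n

end Subcomplex

end Constructions

end CellStructure

namespace PreAbstractSimplicialComplex

variable {V : Type u} [LinearOrder V]

/-- The cell structure of an abstract simplicial complex with ordered vertices: a simplex with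
`n + 1` vertices has dimension `n`, and each simplex is oriented by the order of its vertices, so
that the face `τ \ {v}` has incidence number `(-1) ^ i` in `τ` if `v` is the `i`-th vertex of `τ`
(counted from `0`). -/
noncomputable def cellStructure (K : PreAbstractSimplicialComplex V) : CellStructure K where
  faces τ := open Classical in τ.1.powerset.subtype (· ∈ K)
  mem_faces := by
    intro c' c
    simp [← Subtype.coe_le_coe]
  dim τ := τ.1.card - 1
  inc σ τ := ∑ v ∈ τ.1, if τ.1.erase v = σ.1 then (-1) ^ {w ∈ τ.1 | w < v}.card else 0
  le_of_inc := by
    intro σ τ h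
    obtain ⟨v, _, hv⟩ := Finset.exists_ne_zero_of_sum_ne_zero h
    have : τ.1.erase v = σ.1 := by
      by_contra h1
      simp [h1] at hv
    exact Subtype.coe_le_coe.1 (this ▸ Finset.erase_subset v τ.1)
  dim_of_inc := by
    intro σ τ h
    obtain ⟨v, hvt, hv⟩ := Finset.exists_ne_zero_of_sum_ne_zero h
    have h1 : τ.1.erase v = σ.1 := by
      by_contra h1
      simp [h1] at hv
    have h2 := Finset.card_erase_add_one hvt
    rw [h1] at h2
    have h3 : 0 < σ.1.card := Finset.card_pos.2 (K.isRelLowerSet_faces σ.2).1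
    omega
  sum_inc_mul_inc := by
    classical
    intro ρ τ
    have key : ∀ v ∈ τ.1, ∑ σ ∈ (τ.1.powerset.subtype (· ∈ K) : Finset K),
        (∑ w ∈ σ.1, if σ.1.erase w = ρ.1 then (-1 : ℤ) ^ {x ∈ σ.1 | x < w}.card else 0) *
          (if τ.1.erase v = σ.1 then (-1) ^ {x ∈ τ.1 | x < v}.card else 0) =
        ∑ w ∈ τ.1.erase v, if (τ.1.erase v).erase w = ρ.1 then
          (-1 : ℤ) ^ {x ∈ τ.1.erase v | x < w}.card * (-1) ^ {x ∈ τ.1 | x < v}.card else 0 := by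
      intro v hv
      by_cases hne : (τ.1.erase v).Nonempty
      · have hK : τ.1.erase v ∈ K :=
          (K.isRelLowerSet_faces τ.2).2 (Finset.erase_subset v τ.1) hne
        rw [Finset.sum_eq_single ⟨τ.1.erase v, hK⟩]
        · simp only [if_true, Finset.sum_mul, ite_mul, zero_mul]
        · intro σ _ hσ
          rw [if_neg, mul_zero]
          exact fun h => hσ (Subtype.ext h.symm)
        · intro h
          exact absurd (by simp [Finset.erase_subset]) h
      · rw [Finset.not_nonempty_iff_eq_empty] at hne
        rw [hne, Finset.sum_empty]
        refine Finset.sum_eq_zero fun σ _ => ?_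
        rw [if_neg, mul_zero]
        exact (K.isRelLowerSet_faces σ.2).1.ne_empty.symm
    simp only [Finset.mul_sum]
    rw [Finset.sum_comm]
    refine (Finset.sum_congr rfl key).trans ?_
    rw [Finset.sum_sigma']
    refine Finset.sum_involution (fun p _ => ⟨p.2, p.1⟩) ?_ ?_ ?_ ?_
    · rintro ⟨v, w⟩ h
      simp only [Finset.mem_sigma, Finset.mem_erase] at h
      obtain ⟨hv, hwv, hw⟩ := h
      dsimp only
      rw [Finset.erase_right_comm (a := w) (b := v)]
      by_cases hρ : (τ.1.erase v).erase w = ρ.1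
      · simp only [hρ, if_true]
        have hf : ∀ a b : V, {x ∈ τ.1.erase a | x < b} = {x ∈ τ.1 | x < b}.erase a := by
          intro a b
          exact Finset.filter_erase ..
        rw [hf, hf]
        have aux : ∀ a b : V, a ∈ τ.1 → a < b →
            (-1 : ℤ) ^ ({x ∈ τ.1 | x < b}.erase a).card = - (-1) ^ {x ∈ τ.1 | x < b}.card ∧
            {x ∈ τ.1 | x < a}.erase b = {x ∈ τ.1 | x < a} := by
          intro a b ha hab
          constructor
          · have := Finset.card_erase_add_one (s := {x ∈ τ.1 | x < b}) (a := a) (by simp [ha, hab])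
            rw [← this, pow_succ]
            ring
          · exact Finset.erase_eq_of_notMem (by simp [hab.le])
        rcases lt_or_gt_of_ne hwv with hlt | hlt
        · obtain ⟨h1, h2⟩ := aux w v hw hlt
          rw [h1, h2]
          ring
        · obtain ⟨h1, h2⟩ := aux v w hv hlt
          rw [h1, h2]
          ring
      · simp [hρ]
    · rintro ⟨v, w⟩ h _ heq
      simp only [Finset.mem_sigma, Finset.mem_erase] at h
      exact h.2.1 (congrArg Sigma.fst heq)
    · rintro ⟨v, w⟩ h
      simp only [Finset.mem_sigma, Finset.mem_erase] at h ⊢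
      exact ⟨h.2.2, h.2.1.symm, h.1⟩
    · rintro ⟨v, w⟩ _
      rfl

end PreAbstractSimplicialComplex

section Relation

variable {P Q : Type u} [PartialOrder P] [PartialOrder Q]

/-- For a relation `R` (closed under taking faces) between two complexes, the cosheaf `F_K`
of subcomplexes: `F_K(σ)` consists of all cells `τ` related to `σ`, and the extension maps are
the inclusions. -/
def relatedRight (R : LowerSet (P × Q)) : Pᵒᵖ ⥤ LowerSet Q where
  obj σ :=
    { carrier := {τ | (σ.unop, τ) ∈ R}
      lower' := fun _ _ h hR => R.lower (Prod.mk_le_mk.2 ⟨le_rfl, h⟩) hR }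
  map f := homOfLE fun _ hR => R.lower (Prod.mk_le_mk.2 ⟨leOfHom f.unop, le_rfl⟩) hR

/-- The cosheaf `F_M` of subcomplexes: `F_M(τ)` consists of all cells `σ` related to `τ`. -/
def relatedLeft (R : LowerSet (P × Q)) : Qᵒᵖ ⥤ LowerSet P where
  obj τ :=
    { carrier := {σ | (σ, τ.unop) ∈ R}
      lower' := fun _ _ h hR => R.lower (Prod.mk_le_mk.2 ⟨h, le_rfl⟩) hR }
  map f := homOfLE fun _ hR => R.lower (Prod.mk_le_mk.2 ⟨le_rfl, leOfHom f.unop⟩) hR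

end Relation

namespace RelationalComplex

variable {V W : Type u} [LinearOrder V] [LinearOrder W]
  (K : PreAbstractSimplicialComplex V) (M : PreAbstractSimplicialComplex W)
  (R : LowerSet (K × M)) (G : AddCommGrpCat.{u})

/-- The cosheaf `F_K^q` on `K`, `σ ↦ H_q(F_K(σ); G)`. -/
noncomputable def cosheafK (q : ℕ) : (↥K)ᵒᵖ ⥤ AddCommGrpCat.{u} :=
  relatedRight R ⋙ M.cellStructure.subcomplexHomology G q

/-- The cosheaf `F_M^p` on `M`, `τ ↦ H_p(F_M(τ); G)`. -/
noncomputable def cosheafM (p : ℕ) : (↥M)ᵒᵖ ⥤ AddCommGrpCat.{u} :=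
  relatedLeft R ⋙ K.cellStructure.subcomplexHomology G p

/-- The homology `H_n(K ×_R M; G)` of the relational product complex: the cellular homology of the
subcomplex of the product cell complex `K × M` consisting of the cells `σ × τ` with `σ R τ`. -/
noncomputable def productHomology (n : ℕ) : AddCommGrpCat.{u} :=
  ((K.cellStructure.prod M.cellStructure).subcomplexHomology G n).obj R

end RelationalComplex

/-- A first quadrant spectral sequence of abelian groups starting at the second page, whose
differentials `d^r` have bidegree `(-r, r - 1)`. -/
abbrev ColumnSpectralSequence :=
  SpectralSequence AddCommGrpCat.{u} (fun r => ComplexShape.spectralSequenceNat (-r, r - 1)) 2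

/-- A first quadrant spectral sequence of abelian groups starting at the second page, whose
differentials `d^r` have bidegree `(r - 1, -r)`. -/
abbrev RowSpectralSequence :=
  SpectralSequence AddCommGrpCat.{u} (fun r => ComplexShape.spectralSequenceNat (r - 1, -r)) 2

/-- Convergence `E^2_{p,q} ⟹ H_{p+q}` of a first quadrant spectral sequence with differentials of
bidegree `(-r, r - 1)` or `(r - 1, -r)`, where `s (p, q)` is the filtration degree of the position
`(p, q)` (it is `p` in the first case and `q` in the second): each `H_n` has a finite filtration
`0 = F 0 ≤ F 1 ≤ ⋯ ≤ F (n + 1) = H_n` (so `F (s + 1)` is the part of filtration degree at most `s`)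
with `F (s + 1) / F s ≅ E^∞_{p,q}` for `p + q = n` and `s = s (p, q)`.
For `r ≥ p + q + 2`, the differentials of `E^r` into and out of the position `(p, q)` vanish,
as their other ends lie outside the first quadrant; so `E^∞_{p,q}` is `E^r_{p,q}` for any such
`r`. -/
def SpectralSequenceConvergesTo {d : ℤ → ℤ × ℤ}
    (E : SpectralSequence AddCommGrpCat.{u} (fun r => ComplexShape.spectralSequenceNat (d r)) 2)
    (s : ℕ × ℕ → ℕ) (H : ℕ → AddCommGrpCat.{u}) : Prop :=
  ∀ n : ℕ, ∃ F : ℕ → AddSubgroup (H n), Monotone F ∧ F 0 = ⊥ ∧ F (n + 1) = ⊤ ∧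
    ∀ p q : ℕ, p + q = n → ∀ (r : ℤ) (hr : (n : ℤ) + 2 ≤ r),
      Nonempty ((E.page r).X (p, q) ≃+
        F (s (p, q) + 1) ⧸ (F (s (p, q))).addSubgroupOf (F (s (p, q) + 1)))

/-! Inside the group of all finitely supported functions `K × M →₀ G`, the product boundary splits
as `dh + dv`: `dh` is the boundary in the first factor, `dv` the boundary in the second with the
sign `(-1) ^ dim σ`. Since `R` is closed under faces, both preserve the functions supported on `R`.
They form a first quadrant double complex whose total homology is `H_n(K ×_R M)`. Filtering the
total complex by `dim σ` gives `E^K`, filtering it by `dim τ` gives `E^M`; both converge to the same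
groups because the total complex is the same. Only the first filtration has to be studied: the
second is the first one after exchanging the factors, which merely moves the sign to the other
differential. This is why the double complex carries general sign functions `s` and `t`.

For the second page, the column over `σ` is, up to sign, the chain complex of `F_K(σ)`. Hence the
vertical homology in degree `q` is `⨁ H_q(F_K(σ))`, the chains of the cosheaf `F_K^q`
(`verticalClass_surjective`, `verticalClass_eq_zero_iff`). The horizontal boundary sends a cycle `b`
in the column over `σ` to a combination of copies of the same `b` in the columns over the faces
`σ'`, with coefficients `[σ' : σ]`. Reading `b` as a cycle of the larger complex `F_K(σ')` is the
extension map, so the induced differential is the cosheaf boundary up to a sign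
(`boundary_verticalClass`), and signs affect neither kernels nor images.

The spectral sequence is the classical one of a bounded filtration. With `Z^r_p = {a ∈ F_p | d a ∈
F_{p-r}}`, the page `E^r_p` is `Z^r_p` modulo `Z^{r-1}_{p-1} + d Z^{r-1}_{p+r-1}`. Its homology is
the next page (`exists_survivors_of_pageD`, `survivors_mem_range_pageD_iff`), and for `r ≥ n + 2` it
is the graded piece of the filtered homology (`exists_filtration`). The main isomorphisms, from page
homology to the next page, from late pages to graded pieces and from the second page to cosheaf
homology, all come from two surjections out of one group of explicit elements having the same kernel
(`equivOfSurjective`). -/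

namespace CategoryTheory.ShortComplex

/-! ### Homology of complexes of abelian groups through explicit cycles -/

section HomologyClass

variable (S : ShortComplex AddCommGrpCat.{u}) {Z : Type*} [AddCommGroup Z]

/-- The homology classes of a family of cycles, parametrised additively by `Z`. -/
noncomputable def homologyClass (ψ : Z →+ S.X₂) (h : ∀ z, S.g (ψ z) = 0) : Z →+ S.homology :=
  S.homologyπ.hom.comp (S.abCyclesIso.inv.hom.comp (ψ.codRestrict S.g.hom.ker h))

variable {S}

theorem iCycles_abCyclesIso_inv (x : S.g.hom.ker) :
    S.iCycles (S.abCyclesIso.inv x) = x.1 :=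
  S.abCyclesIso_inv_apply_iCycles x

theorem homologyπ_surjective : Function.Surjective S.homologyπ :=
  (AddCommGrpCat.epi_iff_surjective _).1 inferInstance

theorem iCycles_injective : Function.Injective S.iCycles :=
  (AddCommGrpCat.mono_iff_injective _).1 inferInstance

theorem homologyπ_eq_zero_iff (x : S.cycles) :
    S.homologyπ x = 0 ↔ ∃ y, S.f y = S.iCycles x := by
  have hex : (ShortComplex.mk S.toCycles S.homologyπ S.toCycles_comp_homologyπ).Exact :=
    ShortComplex.exact_of_g_is_cokernel _ S.homologyIsCokernel
  rw [ab_exact_iff] at hex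
  constructor
  · intro h
    obtain ⟨y, hy⟩ := hex x h
    refine ⟨y, ?_⟩
    rw [← hy]
    exact (ConcreteCategory.congr_hom S.toCycles_i y).symm
  · rintro ⟨y, hy⟩
    have : x = S.toCycles y := by
      apply iCycles_injective
      rw [← hy]
      exact (ConcreteCategory.congr_hom S.toCycles_i y).symm
    rw [this]
    exact ConcreteCategory.congr_hom S.toCycles_comp_homologyπ y

theorem homologyClass_surjective (ψ : Z →+ S.X₂) (h : ∀ z, S.g (ψ z) = 0)
    (hs : ∀ x, S.g x = 0 → ∃ z, ψ z = x) : Function.Surjective (S.homologyClass ψ h) := by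
  intro y
  obtain ⟨c, rfl⟩ := homologyπ_surjective y
  obtain ⟨z, hz⟩ := hs (S.iCycles c) (ConcreteCategory.congr_hom S.iCycles_g c)
  refine ⟨z, congrArg S.homologyπ (iCycles_injective ?_)⟩
  rw [← hz]
  exact iCycles_abCyclesIso_inv _

/-- Together with surjectivity this determines the homology as `Z` modulo the elements whose image
under `ψ` is a boundary, so it can be compared with any other quotient of `Z`. -/
theorem homologyClass_eq_zero_iff (ψ : Z →+ S.X₂) (h : ∀ z, S.g (ψ z) = 0) (z : Z) :
    S.homologyClass ψ h z = 0 ↔ ∃ y, S.f y = ψ z := by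
  refine (homologyπ_eq_zero_iff _).trans ?_
  refine exists_congr fun y => ?_
  exact Eq.congr_right (iCycles_abCyclesIso_inv (S := S) ⟨ψ z, h z⟩)

theorem homologyMap_homologyClass {S' : ShortComplex AddCommGrpCat.{u}} (φ : S ⟶ S')
    (ψ : Z →+ S.X₂) (h : ∀ z, S.g (ψ z) = 0) {Z' : Type*} [AddCommGroup Z']
    (ψ' : Z' →+ S'.X₂) (h' : ∀ z, S'.g (ψ' z) = 0) {z : Z} {z' : Z'} (hz : φ.τ₂ (ψ z) = ψ' z') :
    homologyMap φ (S.homologyClass ψ h z) = S'.homologyClass ψ' h' z' := by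
  refine (ConcreteCategory.congr_hom (homologyπ_naturality φ) _).trans ?_
  refine congrArg S'.homologyπ (iCycles_injective ?_)
  refine (ConcreteCategory.congr_hom (cyclesMap_i φ) _).trans ?_
  refine (congrArg φ.τ₂ (iCycles_abCyclesIso_inv _)).trans ?_
  exact hz.trans (iCycles_abCyclesIso_inv (S := S') ⟨ψ' z', h' z'⟩).symm

/-- Two surjective homomorphisms with the same kernel have isomorphic targets. -/
noncomputable def _root_.AddMonoidHom.equivOfSurjective {X Y : Type*} [AddCommGroup X]
    [AddCommGroup Y] (f : Z →+ X) (g : Z →+ Y) (hf : Function.Surjective f)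
    (hg : Function.Surjective g) (h : ∀ z, f z = 0 ↔ g z = 0) : X ≃+ Y :=
  (QuotientAddGroup.quotientKerEquivOfSurjective f hf).symm.trans
    ((QuotientAddGroup.quotientAddEquivOfEq (AddSubgroup.ext h)).trans
      (QuotientAddGroup.quotientKerEquivOfSurjective g hg))

end HomologyClass

end CategoryTheory.ShortComplex

namespace HomologicalComplex

variable {κ : Type*} {c : ComplexShape κ} (X : HomologicalComplex AddCommGrpCat.{u} c) (i : κ)
  {Z : Type*} [AddCommGroup Z]

/-- The homology classes of a family of cycles, parametrised additively by `Z`. -/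
noncomputable def homologyClass (ψ : Z →+ X.X i) (h : ∀ z, X.d i (c.next i) (ψ z) = 0) :
    Z →+ X.homology i :=
  (X.sc i).homologyClass ψ h

variable {X i}

theorem homologyClass_surjective (ψ : Z →+ X.X i) (h : ∀ z, X.d i (c.next i) (ψ z) = 0)
    (hs : ∀ x, X.d i (c.next i) x = 0 → ∃ z, ψ z = x) :
    Function.Surjective (X.homologyClass i ψ h) :=
  ShortComplex.homologyClass_surjective (S := X.sc i) ψ h hs

theorem homologyClass_eq_zero_iff (ψ : Z →+ X.X i) (h : ∀ z, X.d i (c.next i) (ψ z) = 0) (z : Z) :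
    X.homologyClass i ψ h z = 0 ↔ ∃ y, X.d (c.prev i) i y = ψ z :=
  ShortComplex.homologyClass_eq_zero_iff (S := X.sc i) ψ h z

theorem homologyMap_homologyClass {X' : HomologicalComplex AddCommGrpCat.{u} c} (φ : X ⟶ X')
    (ψ : Z →+ X.X i) (h : ∀ z, X.d i (c.next i) (ψ z) = 0) {Z' : Type*} [AddCommGroup Z']
    (ψ' : Z' →+ X'.X i) (h' : ∀ z, X'.d i (c.next i) (ψ' z) = 0) {z : Z} {z' : Z'}
    (hz : φ.f i (ψ z) = ψ' z') :
    homologyMap φ i (X.homologyClass i ψ h z) = X'.homologyClass i ψ' h' z' :=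
  ShortComplex.homologyMap_homologyClass ((shortComplexFunctor _ c i).map φ) ψ h ψ' h' hz

end HomologicalComplex

/-! ### The pages of a filtered differential group -/

/-- A filtered differential group: a differential `d` on an abelian group `A` and subgroups
`F p n` (filtration degree at most `p`, degree `n`), such that in degree `n` the filtration is
trivial below `0` and stationary from `n` on. -/
structure FilteredDifferential (A : Type u) [AddCommGroup A] where
  /-- the differential -/
  d : A →+ A
  /-- the part of filtration degree at most `p` and degree `n` -/
  F : ℤ → ℤ → AddSubgroup A
  mono : ∀ {p p' : ℤ} (n : ℤ), p ≤ p' → F p n ≤ F p' n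
  d_mem : ∀ {p n : ℤ} {a : A}, a ∈ F p n → d a ∈ F p (n - 1)
  d_d : ∀ a, d (d a) = 0
  eq_zero_of_neg : ∀ {p n : ℤ} {a : A}, p < 0 → a ∈ F p n → a = 0
  le_diag : ∀ p n : ℤ, F p n ≤ F n n

namespace FilteredDifferential

variable {A : Type u} [AddCommGroup A] (D : FilteredDifferential A)

/-- The elements of `F p n` whose differential drops the filtration degree by `r`. -/
def almostCycles (r p n : ℤ) : AddSubgroup A :=
  D.F p n ⊓ (D.F (p - r) (n - 1)).comap D.d

/-- The denominator of the `r`-th page. -/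
def almostBoundaries (r p n : ℤ) : AddSubgroup A :=
  D.almostCycles (r - 1) (p - 1) n ⊔ (D.almostCycles (r - 1) (p + r - 1) (n + 1)).map D.d

variable {D}

theorem mem_almostCycles {r p n : ℤ} {a : A} :
    a ∈ D.almostCycles r p n ↔ a ∈ D.F p n ∧ D.d a ∈ D.F (p - r) (n - 1) :=
  Iff.rfl

theorem mem_almostBoundaries {r p n : ℤ} {a : A} :
    a ∈ D.almostBoundaries r p n ↔ ∃ w ∈ D.almostCycles (r - 1) (p - 1) n,
      ∃ v ∈ D.almostCycles (r - 1) (p + r - 1) (n + 1), w + D.d v = a := by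
  simp [almostBoundaries, AddSubgroup.mem_sup]

variable (D)

/-- The position of filtration degree `p` and degree `n` on the `r`-th page. -/
abbrev pageX (r p n : ℤ) : Type u :=
  D.almostCycles r p n ⧸ (D.almostBoundaries r p n).addSubgroupOf (D.almostCycles r p n)

variable {D} in
theorem pageX_mk_eq_zero_iff {r p n : ℤ} (z : D.almostCycles r p n) :
    (QuotientAddGroup.mk z : D.pageX r p n) = 0 ↔ z.1 ∈ D.almostBoundaries r p n :=
  (QuotientAddGroup.eq_zero_iff z).trans AddSubgroup.mem_addSubgroupOf

/-- The differential on almost cycles. -/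
def almostCyclesD {r p n p' n' : ℤ} (hp : p' = p - r) (hn : n' = n - 1) :
    D.almostCycles r p n →+ D.almostCycles r p' n' :=
  (D.d.comp (D.almostCycles r p n).subtype).codRestrict _ fun z => by
    subst hp hn
    refine mem_almostCycles.2 ⟨z.2.2, ?_⟩
    change D.d (D.d z.1) ∈ D.F _ _
    rw [D.d_d]
    exact zero_mem _

/-- The differential of the `r`-th page. -/
def pageD {r p n p' n' : ℤ} (hp : p' = p - r) (hn : n' = n - 1) :
    D.pageX r p n →+ D.pageX r p' n' :=
  QuotientAddGroup.map _ _ (D.almostCyclesD hp hn) fun z hz => by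
    obtain ⟨w, hw, v, hv, h⟩ := mem_almostBoundaries.1 hz
    -- Since `d (w + d v) = d w` and `p - 1 = p' + r - 1`, the element `w` is an admissible source
    -- for the boundary part of the denominator at `p'`.
    refine mem_almostBoundaries.2 ⟨0, zero_mem _, w, ?_, ?_⟩
    · subst hp hn
      convert hw using 2 <;> ring
    · change _ = D.d z.1
      change _ = z.1 at h
      rw [← h, map_add, D.d_d, add_zero, zero_add]

variable {D} in
theorem pageD_mk {r p n p' n' : ℤ} (hp : p' = p - r) (hn : n' = n - 1)
    (z : D.almostCycles r p n) :
    D.pageD hp hn (QuotientAddGroup.mk z) = QuotientAddGroup.mk (D.almostCyclesD hp hn z) :=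
  rfl

theorem pageD_pageD {r p n p' n' p'' n'' : ℤ} (hp : p' = p - r) (hn : n' = n - 1)
    (hp' : p'' = p' - r) (hn' : n'' = n' - 1) (x : D.pageX r p n) :
    D.pageD hp' hn' (D.pageD hp hn x) = 0 := by
  induction x using QuotientAddGroup.induction_on with
  | H z =>
    rw [pageD_mk, pageD_mk, pageX_mk_eq_zero_iff]
    change D.d (D.d z.1) ∈ D.almostBoundaries _ _ _
    rw [D.d_d]
    exact zero_mem _

/-- The indexing of the pages of the spectral sequence of a filtered differential group: positions
have a filtration degree and a total degree. -/
structure Indexing {κ : Type*} (c : ℤ → ComplexShape κ) where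
  /-- the filtration degree -/
  filt : κ → ℤ
  /-- the total degree -/
  deg : κ → ℤ
  rel_iff : ∀ (r : ℤ) (a b : κ), (c r).Rel a b ↔ filt b = filt a - r ∧ deg b = deg a - 1
  exists_index : ∀ p n : ℤ, 0 ≤ p → p ≤ n → ∃ k, filt k = p ∧ deg k = n
  filt_le : ∀ k, filt k ≤ deg k
  filt_nonneg : ∀ k, 0 ≤ filt k

section Page

variable {κ : Type*} {c : ℤ → ComplexShape κ} (I : Indexing c)

/-- The `r`-th page. -/
noncomputable def page (r : ℤ) : HomologicalComplex AddCommGrpCat.{u} (c r) where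
  X k := AddCommGrpCat.of (D.pageX r (I.filt k) (I.deg k))
  d k k' := open Classical in
    if h : (c r).Rel k k' then
      AddCommGrpCat.ofHom (D.pageD ((I.rel_iff r k k').1 h).1 ((I.rel_iff r k k').1 h).2)
    else 0
  shape k k' h := dif_neg h
  d_comp_d' k k' k'' h h' := by
    rw [dif_pos h, dif_pos h']
    refine AddCommGrpCat.hom_ext (AddMonoidHom.ext fun x => ?_)
    exact D.pageD_pageD _ _ _ _ x

theorem page_d {r : ℤ} {k k' : κ} (h : (c r).Rel k k') :
    (D.page I r).d k k' =
      AddCommGrpCat.ofHom (D.pageD ((I.rel_iff r k k').1 h).1 ((I.rel_iff r k k').1 h).2) :=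
  dif_pos h

/-- The classes on the `r`-th page of the elements that survive to the next page. -/
def survivors {r r' : ℤ} (h : r + 1 = r') (p n : ℤ) : D.almostCycles r' p n →+ D.pageX r p n :=
  (QuotientAddGroup.mk' _).comp (AddSubgroup.inclusion fun _ hz =>
    ⟨hz.1, D.mono _ (by lia) hz.2⟩)

variable {r r' : ℤ} (h : r + 1 = r')

/-- The differential of `z` lies in filtration degree `p - r - 1`, one below the position `p - r`
where it is read, and it is a cycle; so it belongs to the first summand of the denominator. -/
theorem pageD_survivors {p n p' n' : ℤ} (hp : p' = p - r) (hn : n' = n - 1)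
    (z : D.almostCycles r' p n) : D.pageD hp hn (D.survivors h p n z) = 0 := by
  refine (pageX_mk_eq_zero_iff _).2 (mem_almostBoundaries.2
    ⟨D.d z.1, mem_almostCycles.2 ⟨?_, ?_⟩, 0, zero_mem _, ?_⟩)
  · subst hn hp h
    convert (mem_almostCycles.1 z.2).2 using 2
    ring
  · rw [D.d_d]
    exact zero_mem _
  · rw [map_zero, add_zero]
    rfl

/-- If `d z = w + d v` lies in the denominator, then `v` has filtration degree `p - 1`. Replacing
`z` by `z - v` keeps its class and leaves `d (z - v) = w`, which has dropped one step further. -/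
theorem exists_survivors_of_pageD {p n p' n' : ℤ} (hp : p' = p - r) (hn : n' = n - 1)
    (x : D.pageX r p n) (hx : D.pageD hp hn x = 0) : ∃ z, D.survivors h p n z = x := by
  induction x using QuotientAddGroup.induction_on with
  | H z =>
    rw [pageD_mk, pageX_mk_eq_zero_iff] at hx
    obtain ⟨w, hw, v, hv, hwv⟩ := mem_almostBoundaries.1 hx
    change _ = D.d z.1 at hwv
    obtain ⟨hv1, hv2⟩ := mem_almostCycles.1 hv
    subst hp hn h
    rw [show p - r + r - 1 = p - 1 by ring, show n - 1 + 1 = n by ring] at hv1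
    have hv' : v ∈ D.almostBoundaries r p n := by
      refine mem_almostBoundaries.2 ⟨v, mem_almostCycles.2 ⟨hv1, ?_⟩, 0, zero_mem _, by simp⟩
      have : D.d z.1 - w ∈ D.F (p - r) (n - 1) :=
        sub_mem (mem_almostCycles.1 z.2).2 (D.mono _ (by lia) (mem_almostCycles.1 hw).1)
      rw [← hwv, add_sub_cancel_left] at this
      exact D.mono _ (by lia) this
    have h2 : z.1 - v ∈ D.almostCycles (r + 1) p n := by
      refine mem_almostCycles.2
        ⟨sub_mem (mem_almostCycles.1 z.2).1 (D.mono _ (by lia) hv1), ?_⟩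
      rw [map_sub, ← hwv, add_sub_cancel_right]
      convert (mem_almostCycles.1 hw).1 using 2
      ring
    refine ⟨⟨_, h2⟩, ?_⟩
    rw [← sub_eq_zero]
    refine (pageX_mk_eq_zero_iff (_ - z)).2 ?_
    change z.1 - v - z.1 ∈ D.almostBoundaries _ _ _
    rw [sub_sub_cancel_left]
    exact neg_mem hv'

/-- A relation `d y - z = w + d v` reads `z = -w + d (y - v)`. Here `d w = -d z` because `d ∘ d =
0`, so `w` inherits the deeper drop of `z`; thus both terms satisfy the conditions of the next
denominator. -/
theorem survivors_mem_range_pageD_iff {p n p' n' : ℤ} (hp : p = p' - r) (hn : n = n' - 1)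
    (z : D.almostCycles r' p n) :
    (∃ y : D.pageX r p' n', D.pageD hp hn y = D.survivors h p n z) ↔
      z.1 ∈ D.almostBoundaries r' p n := by
  obtain rfl : p' = p + r := by lia
  obtain rfl : n' = n + 1 := by lia
  subst h
  constructor
  · rintro ⟨y, hy⟩
    induction y using QuotientAddGroup.induction_on with
    | H y =>
      rw [← sub_eq_zero] at hy
      obtain ⟨w, hw, v, hv, hwv⟩ := mem_almostBoundaries.1
        ((pageX_mk_eq_zero_iff (D.almostCyclesD hp hn y - _)).1 hy)
      change _ = D.d y.1 - z.1 at hwv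
      obtain ⟨hv1, hv2⟩ := mem_almostCycles.1 hv
      have e : z.1 = -w + D.d (y.1 - v) := by
        rw [map_sub, ← sub_eq_zero, ← sub_eq_zero.2 hwv]
        abel
      refine mem_almostBoundaries.2 ⟨-w, mem_almostCycles.2
        ⟨neg_mem (mem_almostCycles.1 hw).1, ?_⟩, y.1 - v, mem_almostCycles.2 ⟨?_, ?_⟩, e.symm⟩
      · have h1 : D.d (-w) = D.d z.1 := by rw [e, map_add, D.d_d, add_zero]
        rw [h1]
        convert (mem_almostCycles.1 z.2).2 using 2
        ring
      · have := sub_mem (mem_almostCycles.1 y.2).1 (D.mono _ (by lia) hv1 : v ∈ D.F (p + r) (n + 1))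
        convert this using 2
        ring
      · rw [map_sub]
        have := sub_mem (mem_almostCycles.1 y.2).2
          (by convert hv2 using 2; ring : D.d v ∈ D.F (p + r - r) (n + 1 - 1))
        convert this using 2
        ring
  · intro hz
    obtain ⟨w, hw, v, hv, hwv⟩ := mem_almostBoundaries.1 hz
    have hv' : v ∈ D.almostCycles r (p + r) (n + 1) := by
      convert hv using 2 <;> ring
    refine ⟨QuotientAddGroup.mk ⟨v, hv'⟩, ?_⟩
    rw [← sub_eq_zero]
    refine (pageX_mk_eq_zero_iff (D.almostCyclesD hp hn ⟨v, hv'⟩ - _)).2 ?_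
    change D.d v - z.1 ∈ D.almostBoundaries _ _ _
    rw [← hwv, sub_add_cancel_right]
    refine neg_mem (mem_almostBoundaries.2 ⟨w, mem_almostCycles.2
      ⟨(mem_almostCycles.1 hw).1, D.mono _ (by lia) (mem_almostCycles.1 hw).2⟩, 0,
      zero_mem _, by simp⟩)

/-- The source of the incoming differential would have filtration degree above its total degree.
There the filtration is already stationary, so `y` also lies in degree `p + r - 1` and `d y` is
already in the denominator. -/
theorem survivors_eq_zero_iff {p n : ℤ} (hpn : n + 1 < p + r) (z : D.almostCycles r' p n) :
    D.survivors h p n z = 0 ↔ z.1 ∈ D.almostBoundaries r' p n := by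
  rw [← D.survivors_mem_range_pageD_iff h (p' := p + r) (n' := n + 1) (by ring) (by ring)]
  constructor
  · intro h0
    exact ⟨0, by rw [map_zero, h0]⟩
  · rintro ⟨y, hy⟩
    rw [← hy]
    induction y using QuotientAddGroup.induction_on with
    | H y =>
      rw [pageD_mk, pageX_mk_eq_zero_iff]
      refine mem_almostBoundaries.2 ⟨0, zero_mem _, y.1,
        mem_almostCycles.2 ⟨?_, ?_⟩, by rw [zero_add]; rfl⟩
      · exact D.mono _ (by lia) (D.le_diag _ _ (mem_almostCycles.1 y.2).1)
      · convert (mem_almostCycles.1 y.2).2 using 2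
        ring

/-- The outgoing differential lands in negative filtration degree, where everything vanishes. -/
theorem exists_survivors {p n : ℤ} (hp : p < r) (x : D.pageX r p n) :
    ∃ z, D.survivors h p n z = x := by
  refine D.exists_survivors_of_pageD h rfl rfl x ?_
  induction x using QuotientAddGroup.induction_on with
  | H z =>
    rw [pageD_mk, pageX_mk_eq_zero_iff]
    change D.d z.1 ∈ D.almostBoundaries _ _ _
    rw [D.eq_zero_of_neg (by lia) (mem_almostCycles.1 z.2).2]
    exact zero_mem _

/-- The homology of a page is the next page. -/
noncomputable def pageHomologyEquiv (hr : 1 ≤ r) (k : κ) :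
    (D.page I r).homology k ≃+ D.pageX r' (I.filt k) (I.deg k) := by
  have h0 : ∀ z, (D.page I r).d k ((c r).next k) (D.survivors h (I.filt k) (I.deg k) z) = 0 := by
    intro z
    by_cases hk : (c r).Rel k ((c r).next k)
    · rw [page_d _ _ hk]
      exact D.pageD_survivors h _ _ z
    · rw [HomologicalComplex.shape _ _ _ hk]
      rfl
  refine AddMonoidHom.equivOfSurjective
    ((D.page I r).homologyClass k (D.survivors h (I.filt k) (I.deg k)) h0)
    (QuotientAddGroup.mk' _) (HomologicalComplex.homologyClass_surjective _ _ fun x hx => ?_)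
    (QuotientAddGroup.mk'_surjective _) fun z => ?_
  · by_cases hk : (c r).Rel k ((c r).next k)
    · rw [page_d _ _ hk] at hx
      exact D.exists_survivors_of_pageD h _ _ x hx
    · refine D.exists_survivors h ?_ x
      -- If `r ≤ filt k`, the target position lies in the quadrant (`1 ≤ r` keeps its filtration
      -- degree at most its total degree), so `k` would have a successor.
      by_contra hlt
      obtain ⟨k', h1, h2⟩ := I.exists_index (I.filt k - r) (I.deg k - 1) (by lia)
        (by have := I.filt_le k; lia)
      have := (I.rel_iff r k k').2 ⟨h1, h2⟩
      exact hk (by rwa [(c r).next_eq' this])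
  · refine (HomologicalComplex.homologyClass_eq_zero_iff _ _ z).trans ?_
    refine Iff.trans ?_ (pageX_mk_eq_zero_iff z).symm
    by_cases hk : (c r).Rel ((c r).prev k) k
    · rw [page_d _ _ hk]
      exact D.survivors_mem_range_pageD_iff h _ _ z
    · rw [HomologicalComplex.shape _ _ _ hk]
      -- Otherwise the position with filtration degree `filt k + r` and total degree `deg k + 1` is
      -- in the quadrant and precedes `k`.
      have hlt : I.deg k + 1 < I.filt k + r := by
        by_contra hlt
        obtain ⟨k', h1, h2⟩ := I.exists_index (I.filt k + r) (I.deg k + 1)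
          (by have := I.filt_nonneg k; lia) (by lia)
        have := (I.rel_iff r k' k).2 ⟨by lia, by lia⟩
        exact hk (by rwa [(c r).prev_eq' this])
      rw [← D.survivors_eq_zero_iff h hlt z]
      exact ⟨fun ⟨y, hy⟩ => hy.symm, fun h => ⟨0, h.symm⟩⟩

/-- The spectral sequence of a filtered differential group. -/
noncomputable def spectralSequence : SpectralSequence AddCommGrpCat.{u} c 2 where
  page r _ := D.page I r
  iso _ _ k hrr' _ := (D.pageHomologyEquiv I hrr' (by lia) k).toAddCommGrpIso

end Page

end FilteredDifferential

/-! ### Stationary pages and the filtration of homology -/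

namespace FilteredDifferential

variable {A : Type u} [AddCommGroup A] (D : FilteredDifferential A)

/-- The cycles of degree `n`. -/
def cycles (n : ℤ) : AddSubgroup A := D.F n n ⊓ D.d.ker

variable {D}

theorem mem_cycles {n : ℤ} {a : A} : a ∈ D.cycles n ↔ a ∈ D.F n n ∧ D.d a = 0 := Iff.rfl

/-- If `H` is the homology in degree `n` of a filtered differential group, then `H` has a finite
filtration whose graded pieces are the stationary values of the pages. -/
theorem exists_filtration {H : Type*} [AddCommGroup H] (n : ℕ) (π : D.cycles n →+ H)
    (hπ : Function.Surjective π)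
    (hker : ∀ z, π z = 0 ↔ ∃ b ∈ D.F (n + 1) (n + 1), D.d b = z) :
    ∃ Φ : ℕ → AddSubgroup H, Monotone Φ ∧ Φ 0 = ⊥ ∧ Φ (n + 1) = ⊤ ∧
      ∀ (s : ℕ) (r : ℤ), (n : ℤ) + 2 ≤ r → s ≤ n →
        Nonempty (D.pageX r s n ≃+ Φ (s + 1) ⧸ (Φ s).addSubgroupOf (Φ (s + 1))) := by
  -- The shift by one makes `Φ 0` the part of filtration degree `-1`, which is zero.
  set Φ : ℕ → AddSubgroup H := fun s => ((D.F (s - 1) n).addSubgroupOf (D.cycles n)).map π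
  have mem : ∀ s x, x ∈ Φ s ↔ ∃ z : D.cycles n, z.1 ∈ D.F (s - 1) n ∧ π z = x := fun s x => Iff.rfl
  refine ⟨Φ, ?_, ?_, ?_, ?_⟩
  · rintro s t hst x ⟨z, hz, rfl⟩
    exact (mem _ _).2 ⟨z, D.mono _ (by lia) hz, rfl⟩
  · refine (AddSubgroup.eq_bot_iff_forall _).2 ?_
    rintro x ⟨z, hz, rfl⟩
    have hz' : z.1 ∈ D.F (((0 : ℕ) : ℤ) - 1) n := hz
    rw [show z = 0 from Subtype.ext (D.eq_zero_of_neg (by simp) hz'), map_zero]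
  · refine eq_top_iff.2 fun x _ => ?_
    obtain ⟨z, rfl⟩ := hπ x
    exact (mem _ _).2 ⟨z, D.mono _ (by lia) (mem_cycles.1 z.2).1, rfl⟩
  · intro s r hr hs
    -- Here `s ≤ n < r`, so the differential of an almost cycle lies in negative filtration degree
    -- and vanishes.
    have hZ : ∀ z ∈ D.almostCycles r s n, z ∈ D.cycles n := fun z hz =>
      mem_cycles.2 ⟨D.le_diag _ _ (mem_almostCycles.1 hz).1,
        D.eq_zero_of_neg (by lia) (mem_almostCycles.1 hz).2⟩
    let φ : D.almostCycles r s n →+ Φ (s + 1) :=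
      (π.comp (AddSubgroup.inclusion hZ)).codRestrict _ fun z =>
        (mem _ _).2 ⟨⟨z.1, hZ _ z.2⟩, by simpa using (mem_almostCycles.1 z.2).1, rfl⟩
    refine ⟨AddMonoidHom.equivOfSurjective (QuotientAddGroup.mk' _)
      ((QuotientAddGroup.mk' ((Φ s).addSubgroupOf (Φ (s + 1)))).comp φ)
      (QuotientAddGroup.mk'_surjective _) ?_ fun z => ?_⟩
    · refine (QuotientAddGroup.mk'_surjective _).comp ?_
      rintro ⟨x, hx⟩
      obtain ⟨z, hz, rfl⟩ := (mem _ _).1 hx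
      refine ⟨⟨z.1, mem_almostCycles.2 ⟨by simpa using hz, ?_⟩⟩, rfl⟩
      rw [(mem_cycles.1 z.2).2]
      exact zero_mem _
    · refine (pageX_mk_eq_zero_iff z).trans ?_
      refine Iff.trans ?_ (QuotientAddGroup.eq_zero_iff (φ z)).symm
      rw [AddSubgroup.mem_addSubgroupOf, mem, mem_almostBoundaries]
      constructor
      · rintro ⟨w, hw, v, hv, hwv⟩
        have hw0 : D.d w = 0 := D.eq_zero_of_neg (by lia) (mem_almostCycles.1 hw).2
        have hw' : w ∈ D.cycles n := mem_cycles.2 ⟨D.le_diag _ _ (mem_almostCycles.1 hw).1, hw0⟩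
        refine ⟨⟨w, hw'⟩, (mem_almostCycles.1 hw).1, ?_⟩
        change _ = π ⟨z.1, hZ _ z.2⟩
        rw [eq_comm, ← sub_eq_zero, ← map_sub, hker]
        exact ⟨v, D.le_diag _ _ (mem_almostCycles.1 hv).1, eq_sub_of_add_eq' hwv⟩
      · rintro ⟨w, hw, hwz⟩
        change _ = π ⟨z.1, hZ _ z.2⟩ at hwz
        rw [eq_comm, ← sub_eq_zero, ← map_sub, hker] at hwz
        obtain ⟨v, hv, hwv⟩ := hwz
        change D.d v = z.1 - w.1 at hwv
        -- The bound `n + 2 ≤ r` gives `n + 1 ≤ s + r - 1`, so every chain of degree `n + 1` is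
        -- allowed as `v`.
        refine ⟨w, mem_almostCycles.2 ⟨hw, ?_⟩, v, mem_almostCycles.2 ⟨D.mono _ (by lia) hv, ?_⟩,
          by rw [hwv, add_sub_cancel]⟩
        · rw [(mem_cycles.1 w.2).2]
          exact zero_mem _
        · rw [hwv]
          have := sub_mem (mem_almostCycles.1 z.2).1 (D.mono _ (by lia) hw : w.1 ∈ D.F s n)
          convert this using 2 <;> ring

end FilteredDifferential

/-! ### Functions supported on a set of cells -/

namespace Finsupp

/-- The finitely supported functions with support in `s`. -/
def supportedOn {ι : Type*} (G : Type*) [AddCommGroup G] (s : Set ι) : AddSubgroup (ι →₀ G) where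
  carrier := {a | ∀ c, a c ≠ 0 → c ∈ s}
  zero_mem' := by simp
  add_mem' {a b} ha hb c hc := by
    by_contra h
    exact hc (by rw [Finsupp.add_apply, not_imp_comm.1 (ha c) h, not_imp_comm.1 (hb c) h, add_zero])
  neg_mem' {a} ha c hc := ha c (by simpa using hc)

variable {ι : Type*} {G : Type*} [AddCommGroup G] {s t : Set ι}

theorem mem_supportedOn {a : ι →₀ G} : a ∈ supportedOn G s ↔ ∀ c, a c ≠ 0 → c ∈ s := Iff.rfl

theorem supportedOn_mono (h : s ⊆ t) : supportedOn G s ≤ supportedOn G t :=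
  fun _ ha c hc => h (ha c hc)

theorem single_mem_supportedOn {c : ι} (h : c ∈ s) (g : G) : single c g ∈ supportedOn G s := by
  classical
  intro c' hc'
  rw [single_apply] at hc'
  by_cases hcc : c = c'
  · exact hcc ▸ h
  · simp [hcc] at hc'

theorem map_mem_of_mem_supportedOn {B : Type*} [AddCommGroup B] (f : (ι →₀ G) →+ B)
    {T : AddSubgroup B} (h : ∀ c ∈ s, ∀ g, f (single c g) ∈ T) {a : ι →₀ G}
    (ha : a ∈ supportedOn G s) : f a ∈ T := by
  rw [← sum_single a, Finsupp.sum, map_sum]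
  exact sum_mem fun c hc => h c (ha c (mem_support_iff.1 hc)) _

theorem eq_zero_of_mem_supportedOn_of_disjoint (h : Disjoint s t) {a : ι →₀ G}
    (ha : a ∈ supportedOn G s) (hb : a ∈ supportedOn G t) : a = 0 := by
  ext c
  by_contra hc
  exact Set.disjoint_left.1 h (ha c hc) (hb c hc)

end Finsupp

/-! ### Double complexes and the second page of the total complex -/

open Finsupp

/-- A double complex of the form `⨁_c G`, where the index `c` lies in bidegree `(x c, y c)` and
runs through a subset `L`. -/
structure BasedDoubleComplex (ι : Type u) (G : Type u) [AddCommGroup G] where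
  /-- the first degree -/
  x : ι → ℕ
  /-- the second degree -/
  y : ι → ℕ
  /-- the basis elements that belong to the double complex -/
  L : Set ι
  /-- the differential lowering the first degree -/
  dh : (ι →₀ G) →+ (ι →₀ G)
  /-- the differential lowering the second degree -/
  dv : (ι →₀ G) →+ (ι →₀ G)
  dh_single : ∀ c ∈ L, ∀ g, dh (single c g) ∈
    supportedOn G {c' | c' ∈ L ∧ x c = x c' + 1 ∧ y c' = y c}
  dv_single : ∀ c ∈ L, ∀ g, dv (single c g) ∈
    supportedOn G {c' | c' ∈ L ∧ x c' = x c ∧ y c = y c' + 1}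
  dh_dh : ∀ a, dh (dh a) = 0
  dv_dv : ∀ a, dv (dv a) = 0
  dh_dv : ∀ a, dh (dv a) = -dv (dh a)

namespace BasedDoubleComplex

variable {ι G : Type u} [AddCommGroup G] (D : BasedDoubleComplex ι G)

/-- The part of bidegree `(p, q)`. -/
def part (p q : ℤ) : AddSubgroup (ι →₀ G) := supportedOn G {c | c ∈ D.L ∧ D.x c = p ∧ D.y c = q}

/-- The part of total degree `n` and first degree at most `p`. -/
def filt (p n : ℤ) : AddSubgroup (ι →₀ G) :=
  supportedOn G {c | c ∈ D.L ∧ (D.x c : ℤ) + D.y c = n ∧ (D.x c : ℤ) ≤ p}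

variable {D}

theorem dh_mem_part {p q p' : ℤ} {a : ι →₀ G} (ha : a ∈ D.part p q) (hp : p = p' + 1) :
    D.dh a ∈ D.part p' q := by
  refine map_mem_of_mem_supportedOn D.dh (fun c hc g => ?_) ha
  obtain ⟨hc, hx, hy⟩ := hc
  refine supportedOn_mono ?_ (D.dh_single c hc g)
  rintro c' ⟨hc', hx', hy'⟩
  exact ⟨hc', by lia, by lia⟩

theorem dv_mem_part {p q q' : ℤ} {a : ι →₀ G} (ha : a ∈ D.part p q) (hq : q = q' + 1) :
    D.dv a ∈ D.part p q' := by
  refine map_mem_of_mem_supportedOn D.dv (fun c hc g => ?_) ha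
  obtain ⟨hc, hx, hy⟩ := hc
  refine supportedOn_mono ?_ (D.dv_single c hc g)
  rintro c' ⟨hc', hx', hy'⟩
  exact ⟨hc', by lia, by lia⟩

theorem dh_mem_filt {p n p' n' : ℤ} {a : ι →₀ G} (ha : a ∈ D.filt p n) (hp : p ≤ p' + 1)
    (hn : n = n' + 1) : D.dh a ∈ D.filt p' n' := by
  refine map_mem_of_mem_supportedOn D.dh (fun c hc g => ?_) ha
  obtain ⟨hc, hx, hy⟩ := hc
  refine supportedOn_mono ?_ (D.dh_single c hc g)
  rintro c' ⟨hc', hx', hy'⟩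
  exact ⟨hc', by lia, by lia⟩

theorem dv_mem_filt {p n n' : ℤ} {a : ι →₀ G} (ha : a ∈ D.filt p n)
    (hn : n = n' + 1) : D.dv a ∈ D.filt p n' := by
  refine map_mem_of_mem_supportedOn D.dv (fun c hc g => ?_) ha
  obtain ⟨hc, hx, hy⟩ := hc
  refine supportedOn_mono ?_ (D.dv_single c hc g)
  rintro c' ⟨hc', hx', hy'⟩
  exact ⟨hc', by lia, by lia⟩

theorem filt_mono {p p' : ℤ} (n : ℤ) (h : p ≤ p') : D.filt p n ≤ D.filt p' n :=
  supportedOn_mono fun _ hc => ⟨hc.1, hc.2.1, hc.2.2.trans h⟩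

theorem part_le_filt {p q p' n : ℤ} (hn : p + q = n) (hp : p ≤ p') : D.part p q ≤ D.filt p' n :=
  supportedOn_mono fun _ hc => ⟨hc.1, by obtain ⟨_, _, _⟩ := hc; lia, hc.2.1.trans_le hp⟩

/-- Equations between leading terms are obtained this way: an element of pure first degree `p`
vanishes as soon as it can be rewritten as a sum of terms of lower filtration degree. -/
theorem eq_zero_of_mem_part_of_mem_filt {p q p' n : ℤ} {a : ι →₀ G} (ha : a ∈ D.part p q)
    (ha' : a ∈ D.filt p' n) (h : p' < p) : a = 0 := by
  refine eq_zero_of_mem_supportedOn_of_disjoint (Set.disjoint_left.2 ?_) ha ha'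
  rintro c ⟨_, h1, _⟩ ⟨_, _, h2⟩
  lia

variable (D)

/-- The total complex, filtered by the first degree. -/
noncomputable def total : FilteredDifferential (ι →₀ G) where
  d := D.dh + D.dv
  F := D.filt
  mono := filt_mono
  d_mem ha := add_mem (dh_mem_filt ha (by lia) (by lia)) (dv_mem_filt ha (by lia))
  d_d a := by
    simp only [AddMonoidHom.add_apply, map_add, D.dh_dh, D.dv_dv, D.dh_dv]
    abel
  eq_zero_of_neg {p n a} hp ha := by
    ext c
    by_contra hc
    obtain ⟨_, _, h⟩ := ha c hc
    lia
  le_diag p n := supportedOn_mono fun c hc => ⟨hc.1, hc.2.1, by obtain ⟨_, _, _⟩ := hc; lia⟩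

/-- The component of first degree `p`. -/
noncomputable def comp (p : ℤ) : (ι →₀ G) →+ (ι →₀ G) :=
  open Classical in filterAddHom fun c => (D.x c : ℤ) = p

variable {D}

theorem comp_mem_part {p q n : ℤ} {a : ι →₀ G} (ha : a ∈ D.filt p n) (hn : p + q = n) :
    D.comp p a ∈ D.part p q := by
  classical
  intro c hc
  change a.filter (fun c => (D.x c : ℤ) = p) c ≠ 0 at hc
  rw [filter_apply] at hc
  split_ifs at hc with h
  · obtain ⟨h1, h2, h3⟩ := ha c hc
    exact ⟨h1, h, by lia⟩
  · exact absurd rfl hc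

theorem sub_comp_mem_filt {p p' n : ℤ} {a : ι →₀ G} (ha : a ∈ D.filt p n) (hp : p = p' + 1) :
    a - D.comp p a ∈ D.filt p' n := by
  classical
  intro c hc
  change a c - a.filter (fun c => (D.x c : ℤ) = p) c ≠ 0 at hc
  rw [filter_apply] at hc
  split_ifs at hc with h
  · simp at hc
  · obtain ⟨h1, h2, h3⟩ := ha c (by simpa using hc)
    exact ⟨h1, h2, by lia⟩

theorem comp_of_mem_part {p q : ℤ} {a : ι →₀ G} (ha : a ∈ D.part p q) : D.comp p a = a := by
  classical
  ext c
  change a.filter (fun c => (D.x c : ℤ) = p) c = _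
  rw [filter_apply]
  split_ifs with h
  · rfl
  · by_contra h0
    exact h (ha c (Ne.symm h0)).2.1

theorem comp_of_mem_filt {p p' n : ℤ} {a : ι →₀ G} (ha : a ∈ D.filt p' n) (hp : p' < p) :
    D.comp p a = 0 := by
  classical
  ext c
  change a.filter (fun c => (D.x c : ℤ) = p) c = 0
  rw [filter_apply]
  split_ifs with h
  · by_contra h0
    have := (ha c h0).2.2
    lia
  · rfl

/-- The component of first degree `p` of the total differential of `a` is `dv` of the leading
component `a_p`, because `dh` lowers the first degree. -/
theorem dv_comp_eq_zero {p p' n : ℤ} {a : ι →₀ G} (ha : a ∈ D.filt p n) (hp : p' < p)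
    (hd : D.dh a + D.dv a ∈ D.filt p' (n - 1)) : D.dv (D.comp p a) = 0 := by
  refine eq_zero_of_mem_part_of_mem_filt (q := n - p - 1) (p' := p - 1) (n := n - 1)
    (dv_mem_part (q := n - p) (comp_mem_part ha (by lia)) (by lia)) ?_ (by lia)
  have h1 : D.dv (a - D.comp p a) ∈ D.filt (p - 1) (n - 1) :=
    dv_mem_filt (sub_comp_mem_filt ha (by lia)) (by lia)
  have h2 : D.dh a ∈ D.filt (p - 1) (n - 1) := dh_mem_filt ha (by lia) (by lia)
  have h3 := sub_mem (sub_mem (filt_mono _ (by lia) hd : _ ∈ D.filt (p - 1) (n - 1)) h1) h2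
  rw [map_sub] at h3
  convert h3 using 1
  abel

/-- In first degree `p - 1` the total differential of `a` has the component `dh a_p + dv a_{p-1}`;
it vanishes once the differential drops by at least two. -/
theorem dh_comp_add_dv_comp_eq_zero {p p' p'' n : ℤ} {a : ι →₀ G} (ha : a ∈ D.filt p n)
    (hp : p = p' + 1) (hp'' : p'' < p')
    (hd : D.dh a + D.dv a ∈ D.filt p'' (n - 1)) :
    D.dh (D.comp p a) + D.dv (D.comp p' (a - D.comp p a)) = 0 := by
  have h0 := dv_comp_eq_zero ha (by lia) hd
  have ha' := sub_comp_mem_filt ha hp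
  have h1 := sub_comp_mem_filt ha' (p' := p' - 1) (by lia)
  refine eq_zero_of_mem_part_of_mem_filt (p := p') (q := n - p) (p' := p' - 1) (n := n - 1)
    (add_mem (dh_mem_part (comp_mem_part ha (by lia)) hp)
      (dv_mem_part (q := n - p') (comp_mem_part ha' (by lia)) (by lia))) ?_ (by lia)
  have h2 : D.dh (a - D.comp p a) ∈ D.filt (p' - 1) (n - 1) := dh_mem_filt ha' (by lia) (by lia)
  have h3 := dv_mem_filt h1 (n' := n - 1) (by lia)
  have h4 := sub_mem (sub_mem (filt_mono _ (by lia) hd : _ ∈ D.filt (p' - 1) (n - 1)) h2) h3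
  rw [map_sub _ (a - _), map_sub _ a, map_sub _ a, h0] at h4
  convert h4 using 1
  abel

variable (D)

/-- The vertical cycles of bidegree `(p, q)`. -/
noncomputable def verticalCycles (p q : ℤ) : AddSubgroup (ι →₀ G) := D.part p q ⊓ D.dv.ker

variable {D}

theorem mem_verticalCycles {p q : ℤ} {a : ι →₀ G} :
    a ∈ D.verticalCycles p q ↔ a ∈ D.part p q ∧ D.dv a = 0 := Iff.rfl

theorem dh_mem_verticalCycles {p q p' : ℤ} {a : ι →₀ G} (ha : a ∈ D.verticalCycles p q)
    (hp : p = p' + 1) : D.dh a ∈ D.verticalCycles p' q := by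
  refine mem_verticalCycles.2 ⟨dh_mem_part ha.1 hp, ?_⟩
  rw [← neg_eq_zero, ← D.dh_dv, (mem_verticalCycles.1 ha).2, map_zero]

theorem mem_almostCycles {r p n : ℤ} {a : ι →₀ G} : a ∈ D.total.almostCycles r p n ↔
    a ∈ D.filt p n ∧ D.dh a + D.dv a ∈ D.filt (p - r) (n - 1) := Iff.rfl

theorem comp_mem_verticalCycles {p q n : ℤ} {a : ι →₀ G} (ha : a ∈ D.total.almostCycles 2 p n)
    (hn : p + q = n) : D.comp p a ∈ D.verticalCycles p q :=
  mem_verticalCycles.2 ⟨comp_mem_part (mem_almostCycles.1 ha).1 hn,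
    dv_comp_eq_zero (mem_almostCycles.1 ha).1 (p' := p - 2) (by lia) (mem_almostCycles.1 ha).2⟩

/-- For `b` of filtration degree `p + 1` with `dv b_{p+1} = 0`, only `b_{p+1}` and `b_p` contribute
to the component of the total differential in first degree `p`. -/
theorem comp_dh_add_dv {p q n : ℤ} {b : ι →₀ G} (hb : b ∈ D.total.almostCycles 1 (p + 1) n)
    (hn : p + q + 1 = n) :
    D.comp p (D.dh b + D.dv b) =
      D.dh (D.comp (p + 1) b) + D.dv (D.comp p (b - D.comp (p + 1) b)) := by
  obtain ⟨hb1, hb2⟩ := mem_almostCycles.1 hb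
  have hb' := sub_comp_mem_filt hb1 (p' := p) rfl
  have e : D.dh b + D.dv b = D.dh (D.comp (p + 1) b) +
      D.dv (D.comp p (b - D.comp (p + 1) b)) + (D.dh (b - D.comp (p + 1) b) +
        D.dv (b - D.comp (p + 1) b - D.comp p (b - D.comp (p + 1) b))) := by
    rw [map_sub D.dv (b - _) (D.comp p _), map_sub D.dv b, map_sub D.dh b,
      dv_comp_eq_zero hb1 (p' := p + 1 - 1) (by lia) hb2]
    abel
  have h1 : D.dh (D.comp (p + 1) b) + D.dv (D.comp p (b - D.comp (p + 1) b)) ∈ D.part p q :=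
    add_mem (dh_mem_part (comp_mem_part hb1 (by lia)) rfl)
      (dv_mem_part (q := q + 1) (comp_mem_part hb' (by lia)) rfl)
  have h2 : D.dh (b - D.comp (p + 1) b) +
      D.dv (b - D.comp (p + 1) b - D.comp p (b - D.comp (p + 1) b)) ∈ D.filt (p - 1) (n - 1) :=
    add_mem (dh_mem_filt hb' (by lia) (by lia))
      (dv_mem_filt (sub_comp_mem_filt hb' (by lia)) (by lia))
  rw [e, map_add, comp_of_mem_part h1, comp_of_mem_filt h2 (by lia), add_zero]

/-- Only the leading component matters: once it has the form `dh b + dv b'` with `dv b = 0`,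
subtracting the total differential of `b + b'` moves `a` into filtration degree `p - 1`, leaving its
own differential unchanged. -/
theorem mem_almostBoundaries_two_iff {p q n : ℤ} {a : ι →₀ G}
    (ha : a ∈ D.total.almostCycles 2 p n) (hn : p + q = n) :
    a ∈ D.total.almostBoundaries 2 p n ↔ ∃ b ∈ D.verticalCycles (p + 1) q,
      ∃ b' ∈ D.part p (q + 1), D.comp p a = D.dh b + D.dv b' := by
  rw [FilteredDifferential.mem_almostBoundaries, show (2 : ℤ) - 1 = 1 by norm_num,
    show p + 2 - 1 = p + 1 by ring]
  constructor
  · rintro ⟨w, hw, b, hb, hwb⟩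
    replace hwb : w + (D.dh b + D.dv b) = a := hwb
    have hw1 := (mem_almostCycles.1 hw).1
    obtain ⟨hb1, hb2⟩ := mem_almostCycles.1 hb
    refine ⟨D.comp (p + 1) b, mem_verticalCycles.2 ⟨comp_mem_part hb1 (by lia),
      dv_comp_eq_zero hb1 (p' := p + 1 - 1) (by lia) hb2⟩, D.comp p (b - D.comp (p + 1) b),
      comp_mem_part (sub_comp_mem_filt hb1 (p' := p) rfl) (by lia), ?_⟩
    rw [← hwb, map_add, comp_of_mem_filt hw1 (by lia), zero_add,
      comp_dh_add_dv hb (q := q) (by lia)]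
  · rintro ⟨b, hb, b', hb', h⟩
    obtain ⟨hb1, hb2⟩ := mem_verticalCycles.1 hb
    have hd1 : D.dh (b + b') + D.dv (b + b') = D.comp p a + D.dh b' := by
      rw [map_add, map_add, hb2, zero_add, h]
      abel
    have hdb' : D.dh b' ∈ D.filt (p - 1) n := dh_mem_filt (n := n + 1)
      (part_le_filt (by lia) le_rfl hb') (by lia) (by lia)
    refine ⟨a - (D.dh (b + b') + D.dv (b + b')), mem_almostCycles.2 ⟨?_, ?_⟩, b + b',
      mem_almostCycles.2 ⟨?_, ?_⟩, sub_add_cancel _ _⟩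
    · rw [hd1, ← sub_sub]
      exact sub_mem (sub_comp_mem_filt (mem_almostCycles.1 ha).1 (by lia)) hdb'
    · have : D.total.d (a - D.total.d (b + b')) = D.total.d a := by
        rw [map_sub, D.total.d_d, sub_zero]
      have h3 : D.total.d (a - D.total.d (b + b')) ∈ D.filt (p - 2) (n - 1) :=
        this ▸ (mem_almostCycles.1 ha).2
      exact filt_mono _ (by lia) h3
    · exact add_mem (part_le_filt (by lia) (by lia) hb1) (part_le_filt (by lia) (by lia) hb')
    · rw [hd1, add_sub_cancel_right, add_sub_cancel_right]
      exact add_mem (part_le_filt (by lia) (by lia)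
        (comp_mem_part (mem_almostCycles.1 ha).1 hn)) (filt_mono _ (by lia) hdb')

/-- The correction `b` cancels `dh z`, so the total differential of `z + b` is just `dh b`, two
filtration steps down. -/
theorem mem_almostCycles_two_of_verticalCycles {p q n : ℤ} {z b : ι →₀ G}
    (hz : z ∈ D.verticalCycles p q) (hn : p + q = n) (hb : b ∈ D.part (p - 1) (q + 1))
    (hzb : D.dh z + D.dv b = 0) :
    z + b ∈ D.total.almostCycles 2 p n ∧ D.comp p (z + b) = z := by
  obtain ⟨hz1, hz2⟩ := mem_verticalCycles.1 hz
  refine ⟨mem_almostCycles.2 ⟨?_, ?_⟩, ?_⟩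
  · exact add_mem (part_le_filt hn le_rfl hz1) (part_le_filt (by lia) (by lia) hb)
  · have : D.dh (z + b) + D.dv (z + b) = D.dh b := by
      rw [map_add, map_add, hz2, zero_add, add_right_comm, hzb, zero_add]
    rw [this]
    exact dh_mem_filt (n := n) (part_le_filt (by lia) le_rfl hb) (by lia) (by lia)
  · rw [map_add, comp_of_mem_part hz1, comp_of_mem_filt (part_le_filt rfl le_rfl hb) (by lia),
      add_zero]

theorem exists_dv_eq_neg_dh_comp {p q n : ℤ} {a : ι →₀ G}
    (ha : a ∈ D.total.almostCycles 2 p n) (hn : p + q = n) :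
    ∃ b ∈ D.part (p - 1) (q + 1), D.dv b = D.dh (D.comp p a) := by
  obtain ⟨h1, h2⟩ := mem_almostCycles.1 ha
  refine ⟨-D.comp (p - 1) (a - D.comp p a), neg_mem
    (comp_mem_part (n := n) (sub_comp_mem_filt h1 (by ring)) (by lia)), ?_⟩
  rw [map_neg, neg_eq_iff_add_eq_zero, add_comm]
  exact dh_comp_add_dv_comp_eq_zero h1 (p'' := p - 2) (by ring) (by lia) h2

theorem eq_zero_of_mem_part_of_neg {p q : ℤ} {a : ι →₀ G} (ha : a ∈ D.part p q) (hp : p < 0) :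
    a = 0 := by
  ext c
  by_contra hc
  obtain ⟨_, h, _⟩ := ha c hc
  lia

/-- The `(p, q)` entry of the second page is the `p`-th homology of the vertical homology in degree
`q`, where the latter is presented by homomorphisms `ψ p` from the vertical cycles that are
compatible with the differentials up to sign. -/
theorem nonempty_pageX_two_equiv (q : ℕ) (X : ChainComplex AddCommGrpCat.{u} ℕ)
    (ψ : ∀ p : ℕ, D.verticalCycles p q →+ X.X p) (hs : ∀ p, Function.Surjective (ψ p))
    (hker : ∀ p z, ψ p z = 0 ↔ ∃ b ∈ D.part p (q + 1), D.dv b = z)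
    (hd : ∀ p z z', D.dh z.1 = z'.1 →
      X.d (p + 1) p (ψ (p + 1) z) = ψ p z' ∨ X.d (p + 1) p (ψ (p + 1) z) = -ψ p z')
    (p : ℕ) (n : ℤ) (hn : (p : ℤ) + q = n) :
    Nonempty (D.total.pageX 2 p n ≃+ X.homology p) := by
  -- An almost cycle is sent to the class of its leading component, which is a vertical cycle.
  let φ : D.total.almostCycles 2 p n →+ X.X p := (ψ p).comp
    (((D.comp p).comp (D.total.almostCycles 2 p n).subtype).codRestrict _ fun z =>
      comp_mem_verticalCycles z.2 hn)
  have hφ : ∀ z z', D.comp p z.1 = z'.1 → φ z = ψ p z' := fun z z' h =>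
    congrArg (ψ p) (Subtype.ext h)
  have hd0 : ∀ p z (hz : z ∈ D.verticalCycles (p + 1 : ℕ) q),
      X.d (p + 1) p (ψ (p + 1) ⟨z, hz⟩) = 0 ↔ ∃ b ∈ D.part p (q + 1), D.dv b = D.dh z := by
    intro p z hz
    refine Iff.trans ?_ (hker p ⟨_, dh_mem_verticalCycles hz (p' := p) (by simp)⟩)
    rcases hd p ⟨z, hz⟩ ⟨_, dh_mem_verticalCycles hz (p' := p) (by simp)⟩ rfl with h | h
    · rw [h]
    · rw [h, neg_eq_zero]
  have h0 : ∀ z, X.d p ((ComplexShape.down ℕ).next p) (φ z) = 0 := by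
    intro z
    rcases p with _ | p
    · rw [X.shape _ _ (by simp)]
      rfl
    · rw [(ComplexShape.down ℕ).next_eq' (show _ from rfl : (ComplexShape.down ℕ).Rel (p + 1) p)]
      refine (hd0 p _ _).2 ?_
      have := exists_dv_eq_neg_dh_comp z.2 hn
      push_cast at this
      rwa [add_sub_cancel_right] at this
  refine ⟨AddMonoidHom.equivOfSurjective (QuotientAddGroup.mk' _)
    (X.homologyClass p φ h0) (QuotientAddGroup.mk'_surjective _)
    (HomologicalComplex.homologyClass_surjective _ _ fun x hx => ?_) fun z => ?_⟩
  · obtain ⟨z, rfl⟩ := hs p x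
    -- A cycle of `X` has a representative `z` with `dh z` a vertical boundary; a bounding element
    -- with reversed sign is the correction that makes `z` an almost cycle. For `p = 0` nothing is
    -- to be corrected.
    have key : ∃ b ∈ D.part (p - 1) (q + 1), D.dh z.1 + D.dv b = 0 := by
      rcases p with _ | p
      · refine ⟨0, zero_mem _, ?_⟩
        rw [map_zero, add_zero]
        exact eq_zero_of_mem_part_of_neg
          (dh_mem_part (mem_verticalCycles.1 z.2).1 (p' := -1) (by simp)) (by simp)
      · rw [(ComplexShape.down ℕ).next_eq' (show _ from rfl : (ComplexShape.down ℕ).Rel (p + 1) p)]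
          at hx
        obtain ⟨b, hb, hb'⟩ := (hd0 p z.1 z.2).1 hx
        exact ⟨-b, neg_mem (by simpa using hb), by rw [map_neg, hb', add_neg_cancel]⟩
    obtain ⟨b, hb, hzb⟩ := key
    obtain ⟨h1, h2⟩ := mem_almostCycles_two_of_verticalCycles z.2 hn hb hzb
    exact ⟨⟨_, h1⟩, hφ _ z h2⟩
  · have e1 := FilteredDifferential.pageX_mk_eq_zero_iff z
    have e2 := HomologicalComplex.homologyClass_eq_zero_iff φ h0 z
    refine e1.trans (Iff.trans ?_ e2.symm)
    rw [(ComplexShape.down ℕ).prev_eq' (show _ from rfl : (ComplexShape.down ℕ).Rel (p + 1) p),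
      mem_almostBoundaries_two_iff z.2 hn]
    have hv : D.comp p z.1 ∈ D.verticalCycles p q := comp_mem_verticalCycles z.2 hn
    rw [hφ z ⟨_, hv⟩ rfl]
    have key : ∀ b (hb : b ∈ D.verticalCycles (p + 1 : ℕ) q),
        ψ p ⟨_, hv⟩ = ψ p ⟨_, dh_mem_verticalCycles hb (p' := p) (by simp)⟩ ↔
          ∃ b' ∈ D.part p (q + 1), D.comp p z.1 = D.dh b + D.dv b' := by
      intro b hb
      rw [← sub_eq_zero, ← map_sub, hker]
      refine exists_congr fun b' => and_congr_right fun _ => ?_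
      change D.dv b' = D.comp p z.1 - D.dh b ↔ _
      rw [eq_sub_iff_add_eq', eq_comm]
    constructor
    · rintro ⟨b, hb, h⟩
      rw [(key b hb).2 h]
      rcases hd p ⟨b, hb⟩ ⟨_, dh_mem_verticalCycles hb (p' := p) (by simp)⟩ rfl with h | h
      · exact ⟨_, h⟩
      · exact ⟨-_, by rw [map_neg, h, neg_neg]⟩
    · rintro ⟨y, hy⟩
      obtain ⟨b, rfl⟩ := hs (p + 1) y
      rcases hd p b ⟨_, dh_mem_verticalCycles b.2 (p' := p) (by simp)⟩ rfl with h | h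
      · exact ⟨b, b.2, (key b b.2).1 (hy.symm.trans h)⟩
      · refine ⟨-b, neg_mem b.2, (key _ (neg_mem b.2)).1 (hy.symm.trans (h.trans ?_))⟩
        rw [← map_neg]
        exact congrArg (ψ p) (Subtype.ext (map_neg D.dh b.1).symm)

end BasedDoubleComplex

/-! ### Coproducts of abelian groups as direct sums -/

namespace AddCommGrpCat

section

variable {J : Type u} [DecidableEq J] (f : J → AddCommGrpCat.{u})

/-- The homomorphism from a coproduct of abelian groups to the direct sum. -/
noncomputable def sigmaToDFinsupp : ∐ f ⟶ AddCommGrpCat.of (Π₀ j, f j) :=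
  Sigma.desc fun j => AddCommGrpCat.ofHom (DFinsupp.singleAddHom (fun j => f j) j)

theorem sigmaToDFinsupp_ι (j : J) (x : f j) :
    sigmaToDFinsupp f (Sigma.ι f j x) = DFinsupp.single j x :=
  ConcreteCategory.congr_hom (Sigma.ι_desc (fun j => AddCommGrpCat.ofHom
    (DFinsupp.singleAddHom (fun j => f j) j)) j) x

/-- Coproducts of abelian groups are direct sums. -/
noncomputable def sigmaEquiv : (∐ f : AddCommGrpCat.{u}) ≃+ Π₀ j, f j :=
  Iso.addCommGroupIsoToAddEquiv (Y := AddCommGrpCat.of (Π₀ j, f j))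
    { hom := sigmaToDFinsupp f
      inv := AddCommGrpCat.ofHom (DFinsupp.sumAddHom fun j => (Sigma.ι f j).hom)
      hom_inv_id := by
        refine Sigma.hom_ext _ _ fun j => AddCommGrpCat.hom_ext (AddMonoidHom.ext fun x => ?_)
        refine (congrArg (DFinsupp.sumAddHom fun j => (Sigma.ι f j).hom)
          (sigmaToDFinsupp_ι f j x)).trans ?_
        exact DFinsupp.sumAddHom_single _ _ _
      inv_hom_id := by
        refine AddCommGrpCat.hom_ext (DFinsupp.addHom_ext fun j x => ?_)
        refine (congrArg (sigmaToDFinsupp f) (DFinsupp.sumAddHom_single _ _ _)).trans ?_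
        exact sigmaToDFinsupp_ι f j x }

theorem sigmaEquiv_ι (j : J) (x : f j) : sigmaEquiv f (Sigma.ι f j x) = DFinsupp.single j x :=
  sigmaToDFinsupp_ι f j x

end

theorem sum_apply {X Y : AddCommGrpCat.{u}} {J : Type*} (s : Finset J) (f : J → (X ⟶ Y)) (x : X) :
    (∑ j ∈ s, f j) x = ∑ j ∈ s, f j x := by
  refine (DFunLike.congr_fun (map_sum AddCommGrpCat.homAddEquiv f s) x).trans ?_
  exact AddMonoidHom.finsetSum_apply _ _ _

end AddCommGrpCat

/-! ### Chains and cycle classes of subcomplexes inside `P →₀ G` -/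

namespace CellStructure

section

variable {P : Type u} [PartialOrder P] (S : CellStructure P) (F : Pᵒᵖ ⥤ AddCommGrpCat.{u}) (n : ℕ)

/-- The chains of a cosheaf of abelian groups as a direct sum. -/
noncomputable def chainsEquiv [DecidableEq P] :
    (S.chains F n : AddCommGrpCat.{u}) ≃+ Π₀ c : {c : P // S.dim c = n}, F.obj (Opposite.op c.1) :=
  AddCommGrpCat.sigmaEquiv _

variable {F n}

theorem chainsEquiv_ιChains [DecidableEq P] {c : P} (hc : S.dim c = n)
    (x : F.obj (Opposite.op c)) :
    S.chainsEquiv F n (S.ιChains F n c x) = DFinsupp.single ⟨c, hc⟩ x := by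
  rw [ιChains_of_dim _ _ hc]
  exact AddCommGrpCat.sigmaEquiv_ι (fun c : {c // S.dim c = n} => F.obj (Opposite.op c.1)) ⟨c, hc⟩ x

/-- The summands generate the chains. With `T` an equalizer, a preimage or a range, this reduces
identities, membership and surjectivity to single cells. -/
theorem mem_of_ιChains_mem (T : AddSubgroup (S.chains F n : AddCommGrpCat.{u}))
    (h : ∀ c, S.dim c = n → ∀ x, S.ιChains F n c x ∈ T) (x : (S.chains F n : AddCommGrpCat.{u})) :
    x ∈ T := by
  classical
  obtain ⟨f, rfl⟩ := (S.chainsEquiv F n).symm.surjective x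
  induction f using DFinsupp.induction with
  | h0 =>
    rw [map_zero]
    exact zero_mem _
  | ha c g f _ _ ih =>
    rw [map_add, ← S.chainsEquiv_ιChains c.2, AddEquiv.symm_apply_apply]
    exact add_mem (h c.1 c.2 g) ih

theorem boundary_ιChains_apply (c : P) (x : F.obj (Opposite.op c)) :
    S.boundary F n (S.ιChains F (n + 1) c x) =
      ∑ c' ∈ S.faces c, S.inc c' c • S.ιChains F n c' (extensionMap F c c' x) := by
  refine (ConcreteCategory.congr_hom (S.ιChains_boundary F n c) x).trans ?_
  exact AddCommGrpCat.sum_apply _ _ _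

end

section

variable {P : Type u} [PartialOrder P] (S : CellStructure P) (G : AddCommGrpCat.{u})

/-- The boundary operator on all chains. -/
noncomputable def finsuppBoundary : (P →₀ G) →+ (P →₀ G) :=
  liftAddHom fun c => ∑ c' ∈ S.faces c, S.inc c' c • singleAddHom c'

theorem finsuppBoundary_single (c : P) (g : G) :
    S.finsuppBoundary G (single c g) = ∑ c' ∈ S.faces c, S.inc c' c • single c' g := by
  rw [finsuppBoundary, liftAddHom_apply_single, AddMonoidHom.finsetSum_apply]
  rfl

/-- The cells of dimension `n` of a subcomplex. -/
def cells (L : LowerSet P) (n : ℕ) : Set P := {c | c ∈ L ∧ S.dim c = n}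

variable {S G} in
theorem finsuppBoundary_eq_zero {L : LowerSet P} {a : P →₀ G}
    (ha : a ∈ supportedOn G (S.cells L 0)) : S.finsuppBoundary G a = 0 := by
  refine AddSubgroup.mem_bot.1 (map_mem_of_mem_supportedOn (S.finsuppBoundary G) ?_ ha)
  rintro c ⟨_, hc⟩ g
  rw [AddSubgroup.mem_bot, finsuppBoundary_single]
  refine Finset.sum_eq_zero fun c' _ => ?_
  by_cases h : S.inc c' c = 0
  · rw [h, zero_smul]
  · have := S.dim_of_inc h
    omega

variable (L : LowerSet P) (n : ℕ)

/-- The chains of a subcomplex with constant coefficients. -/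
noncomputable abbrev constChainsX : AddCommGrpCat.{u} :=
  (S.restrict L).chains ((Functor.const (↥L)ᵒᵖ).obj G) n

/-- The generators of the chains of a subcomplex. -/
noncomputable abbrev constChainsι (c : L) : G ⟶ S.constChainsX G L n :=
  (S.restrict L).ιChains ((Functor.const (↥L)ᵒᵖ).obj G) n c

/-- The chains of a subcomplex as finitely supported functions. -/
noncomputable def chainsToFinsupp : S.constChainsX G L n ⟶ AddCommGrpCat.of (P →₀ G) :=
  Sigma.desc fun c => AddCommGrpCat.ofHom (singleAddHom c.1.1)

theorem chainsToFinsupp_ι {c : L} (hc : S.dim c.1 = n) (g : G) :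
    S.chainsToFinsupp G L n (S.constChainsι G L n c g) = single c.1 g := by
  rw [constChainsι, ιChains_of_dim _ _ (show (S.restrict L).dim c = n from hc)]
  exact ConcreteCategory.congr_hom (Sigma.ι_desc
    (fun c : {c : ↥L // (S.restrict L).dim c = n} =>
      AddCommGrpCat.ofHom (singleAddHom (M := G) c.1.1)) ⟨c, hc⟩) g

/-- Because `L` is closed under faces, the faces of a cell in `L` and in `P` are the same, so the
ambient boundary restricts to the boundary of every subcomplex. -/
theorem chainsToFinsupp_boundary (x : S.constChainsX G L (n + 1)) :
    S.chainsToFinsupp G L n ((S.restrict L).boundary ((Functor.const (↥L)ᵒᵖ).obj G) n x) =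
      S.finsuppBoundary G (S.chainsToFinsupp G L (n + 1) x) := by
  refine (S.restrict L).mem_of_ιChains_mem (((S.chainsToFinsupp G L n).hom.comp
    ((S.restrict L).boundary ((Functor.const (↥L)ᵒᵖ).obj G) n).hom).eqLocus
      ((S.finsuppBoundary G).comp (S.chainsToFinsupp G L (n + 1)).hom)) (fun c hc g => ?_) x
  refine (congrArg (S.chainsToFinsupp G L n).hom
    ((S.restrict L).boundary_ιChains_apply c g)).trans ?_
  refine Eq.trans ?_ (congrArg (S.finsuppBoundary G) (S.chainsToFinsupp_ι G L (n + 1) hc g)).symm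
  rw [map_sum, finsuppBoundary_single]
  have key : ∀ c' ∈ (S.restrict L).faces c, (S.chainsToFinsupp G L n).hom
      ((S.restrict L).inc c' c • (S.restrict L).ιChains ((Functor.const (↥L)ᵒᵖ).obj G) n c'
        (extensionMap ((Functor.const (↥L)ᵒᵖ).obj G) c c' g)) =
      S.inc c'.1 c.1 • single c'.1 g := by
    intro c' hc'
    rw [map_zsmul]
    change S.inc c'.1 c.1 • _ = _
    -- The generator of `c'` is a genuine one only in dimension `n`, which is guaranteed by a
    -- nonzero incidence number; otherwise both sides vanish.
    by_cases h : S.inc c'.1 c.1 = 0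
    · rw [h, zero_smul, zero_smul]
    · have h1 := S.dim_of_inc h
      have h2 : S.dim c.1 = n + 1 := hc
      rw [extensionMap_of_le _ ((mem_faces _).1 hc')]
      exact congrArg _ (S.chainsToFinsupp_ι G L n (by omega) g)
  rw [Finset.sum_congr rfl key]
  refine Finset.sum_bij (fun c' _ => c'.1) ?_ ?_ ?_ ?_
  · intro c' hc'
    exact S.mem_faces.2 ((S.restrict L).mem_faces.1 hc')
  · intro a _ b _ hab
    exact Subtype.ext hab
  · intro b hb
    have hle := S.mem_faces.1 hb
    exact ⟨⟨b, L.lower hle c.2⟩, (mem_faces _).2 hle, rfl⟩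
  · intros
    rfl

theorem chainsToFinsupp_constChainsMapX {L L' : LowerSet P} (h : L ≤ L') (n : ℕ)
    (x : S.constChainsX G L n) :
    S.chainsToFinsupp G L' n (S.constChainsMapX G h n x) = S.chainsToFinsupp G L n x := by
  refine (S.restrict L).mem_of_ιChains_mem (((S.chainsToFinsupp G L' n).hom.comp
    (S.constChainsMapX G h n).hom).eqLocus (S.chainsToFinsupp G L n).hom) (fun c hc g => ?_) x
  refine (congrArg (S.chainsToFinsupp G L' n).hom
    (ConcreteCategory.congr_hom (S.ι_constChainsMapX G h n c) g)).trans ?_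
  exact (S.chainsToFinsupp_ι G L' n (c := ⟨c.1, h c.2⟩) hc g).trans
    (S.chainsToFinsupp_ι G L n hc g).symm

/-- The coordinates of a chain in the direct sum are values of its ambient function, whence the
injectivity of `chainsToFinsupp`. -/
theorem chainsEquiv_apply [DecidableEq P] (x : S.constChainsX G L n)
    (c : {c : L // (S.restrict L).dim c = n}) :
    ((S.restrict L).chainsEquiv ((Functor.const (↥L)ᵒᵖ).obj G) n x) c =
      S.chainsToFinsupp G L n x c.1.1 := by
  refine (S.restrict L).mem_of_ιChains_mem (AddMonoidHom.eqLocus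
    ((DFinsupp.evalAddMonoidHom c).comp
      ((S.restrict L).chainsEquiv ((Functor.const (↥L)ᵒᵖ).obj G) n).toAddMonoidHom)
    ((Finsupp.applyAddHom c.1.1).comp (S.chainsToFinsupp G L n).hom)) (fun c' hc' g => ?_) x
  refine (DFunLike.congr_fun ((S.restrict L).chainsEquiv_ιChains hc' g) c).trans ?_
  refine Eq.trans ?_ (DFunLike.congr_fun (S.chainsToFinsupp_ι G L n hc' g) c.1.1).symm
  by_cases h : (⟨c', hc'⟩ : {c : L // (S.restrict L).dim c = n}) = c
  · subst h
    exact (DFinsupp.single_eq_same).trans (Finsupp.single_eq_same).symm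
  · exact (DFinsupp.single_eq_of_ne (Ne.symm h)).trans (Finsupp.single_eq_of_ne
      fun h' => h (Subtype.ext (Subtype.ext h'.symm))).symm

theorem chainsToFinsupp_injective : Function.Injective (S.chainsToFinsupp G L n) := by
  classical
  intro x y hxy
  refine ((S.restrict L).chainsEquiv ((Functor.const (↥L)ᵒᵖ).obj G) n).injective ?_
  refine DFinsupp.ext fun c => ?_
  exact (S.chainsEquiv_apply G L n x c).trans
    ((DFunLike.congr_fun hxy c.1.1).trans (S.chainsEquiv_apply G L n y c).symm)

theorem chainsToFinsupp_mem (x : S.constChainsX G L n) :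
    S.chainsToFinsupp G L n x ∈ supportedOn G (S.cells L n) := by
  refine (S.restrict L).mem_of_ιChains_mem ((supportedOn G (S.cells L n)).comap
    (S.chainsToFinsupp G L n).hom) (fun c hc g => ?_) x
  refine (congrArg (· ∈ supportedOn G (S.cells L n)) (S.chainsToFinsupp_ι G L n hc g)).mpr ?_
  exact single_mem_supportedOn (s := S.cells L n) (c := c.1) ⟨c.2, hc⟩ g

theorem exists_chainsToFinsupp_eq {a : P →₀ G} (ha : a ∈ supportedOn G (S.cells L n)) :
    ∃ x, S.chainsToFinsupp G L n x = a := by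
  refine map_mem_of_mem_supportedOn (T := (S.chainsToFinsupp G L n).hom.range)
    (AddMonoidHom.id _) ?_ ha
  rintro c ⟨hc, hn⟩ g
  exact ⟨_, S.chainsToFinsupp_ι G L n (c := ⟨c, hc⟩) hn g⟩

/-- The `n`-chains of a subcomplex are the functions supported on its cells of dimension `n`. -/
noncomputable def chainsEquivSupportedOn :
    supportedOn G (S.cells L n) ≃+ S.constChainsX G L n :=
  (AddEquiv.ofBijective ((S.chainsToFinsupp G L n).hom.codRestrict _ (S.chainsToFinsupp_mem G L n))
    ⟨fun _ _ h => S.chainsToFinsupp_injective G L n (congrArg Subtype.val h), fun a => by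
      obtain ⟨x, hx⟩ := S.exists_chainsToFinsupp_eq G L n a.2
      exact ⟨x, Subtype.ext hx⟩⟩).symm

theorem chainsToFinsupp_chainsEquivSupportedOn (a : supportedOn G (S.cells L n)) :
    S.chainsToFinsupp G L n (S.chainsEquivSupportedOn G L n a) = a :=
  congrArg Subtype.val ((S.chainsEquivSupportedOn G L n).symm_apply_apply a)

/-- The `n`-cycles of a subcomplex. -/
noncomputable def cellCycles : AddSubgroup (P →₀ G) :=
  supportedOn G (S.cells L n) ⊓ (S.finsuppBoundary G).ker

variable {S G L n} in
theorem mem_cellCycles {a : P →₀ G} :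
    a ∈ S.cellCycles G L n ↔ a ∈ supportedOn G (S.cells L n) ∧ S.finsuppBoundary G a = 0 :=
  Iff.rfl

variable {S G n} in
theorem cellCycles_mono {L L' : LowerSet P} (h : L ≤ L') :
    S.cellCycles G L n ≤ S.cellCycles G L' n :=
  inf_le_inf_right _ (supportedOn_mono fun _ hc => ⟨h hc.1, hc.2⟩)

theorem constChains_d_chainsEquivSupportedOn_eq_zero_iff (a : supportedOn G (S.cells L n)) :
    (S.constChains G L).d n ((ComplexShape.down ℕ).next n) (S.chainsEquivSupportedOn G L n a) = 0 ↔
      S.finsuppBoundary G a.1 = 0 := by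
  rcases n with _ | n
  · rw [(S.constChains G L).shape _ _ (by simp)]
    exact iff_of_true rfl (finsuppBoundary_eq_zero a.2)
  · rw [(ComplexShape.down ℕ).next_eq' (show _ from rfl : (ComplexShape.down ℕ).Rel (n + 1) n)]
    have h1 : (S.constChains G L).d (n + 1) n = _ := (S.restrict L).chainComplex_d _ n
    have h2 := S.chainsToFinsupp_boundary G L n
      (S.chainsEquivSupportedOn G L (n + 1) a)
    rw [h1]
    refine (map_eq_zero_iff (S.chainsToFinsupp G L n).hom
      (S.chainsToFinsupp_injective G L n)).symm.trans ?_
    refine Eq.congr_left (h2.trans ?_)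
    exact congrArg (S.finsuppBoundary G) (S.chainsToFinsupp_chainsEquivSupportedOn G L (n + 1) a)

theorem constChains_d_eq_zero (a : S.cellCycles G L n) :
    (S.constChains G L).d n ((ComplexShape.down ℕ).next n)
      (((S.chainsEquivSupportedOn G L n).toAddMonoidHom.comp
        (AddSubgroup.inclusion inf_le_left)) a) = 0 :=
  (S.constChains_d_chainsEquivSupportedOn_eq_zero_iff G L n _).2 a.2.2

/-- The homology class of a cycle of a subcomplex. -/
noncomputable def cycleClass :
    S.cellCycles G L n →+ ((S.subcomplexHomology G n).obj L : AddCommGrpCat.{u}) :=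
  (S.constChains G L).homologyClass n ((S.chainsEquivSupportedOn G L n).toAddMonoidHom.comp
    (AddSubgroup.inclusion inf_le_left)) (S.constChains_d_eq_zero G L n)

theorem cycleClass_surjective : Function.Surjective (S.cycleClass G L n) := by
  refine HomologicalComplex.homologyClass_surjective _ _ fun x hx => ?_
  obtain ⟨a, rfl⟩ := (S.chainsEquivSupportedOn G L n).surjective x
  exact ⟨⟨a.1, mem_cellCycles.2
    ⟨a.2, (S.constChains_d_chainsEquivSupportedOn_eq_zero_iff G L n a).1 hx⟩⟩, rfl⟩

theorem cycleClass_eq_zero_iff (z : S.cellCycles G L n) : S.cycleClass G L n z = 0 ↔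
    ∃ b ∈ supportedOn G (S.cells L (n + 1)), S.finsuppBoundary G b = z := by
  refine (HomologicalComplex.homologyClass_eq_zero_iff _ _ z).trans ?_
  rw [(ComplexShape.down ℕ).prev_eq' (show _ from rfl : (ComplexShape.down ℕ).Rel (n + 1) n)]
  have h1 : (S.constChains G L).d (n + 1) n = _ := (S.restrict L).chainComplex_d _ n
  rw [h1]
  have key : ∀ b : supportedOn G (S.cells L (n + 1)),
      (S.restrict L).boundary ((Functor.const (↥L)ᵒᵖ).obj G) n
        (S.chainsEquivSupportedOn G L (n + 1) b) = S.chainsEquivSupportedOn G L n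
          (AddSubgroup.inclusion inf_le_left z) ↔ S.finsuppBoundary G b = z := by
    intro b
    rw [← (S.chainsToFinsupp_injective G L n).eq_iff]
    refine Eq.congr ?_ (S.chainsToFinsupp_chainsEquivSupportedOn G L n _)
    refine (S.chainsToFinsupp_boundary G L n _).trans ?_
    exact congrArg (S.finsuppBoundary G) (S.chainsToFinsupp_chainsEquivSupportedOn G L (n + 1) b)
  constructor
  · rintro ⟨y, hy⟩
    obtain ⟨b, rfl⟩ := (S.chainsEquivSupportedOn G L (n + 1)).surjective y
    exact ⟨b.1, b.2, (key b).1 hy⟩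
  · rintro ⟨b, hb, hbz⟩
    exact ⟨_, (key ⟨b, hb⟩).2 hbz⟩

/-- An inclusion of subcomplexes leaves the underlying function in `P →₀ G` unchanged, so the
induced map just reads the same cycle in the larger subcomplex. -/
theorem subcomplexHomology_map_cycleClass {L L' : LowerSet P} (f : L ⟶ L') (n : ℕ)
    {z : S.cellCycles G L n} {z' : S.cellCycles G L' n} (hz : z.1 = z'.1) :
    (S.subcomplexHomology G n).map f (S.cycleClass G L n z) = S.cycleClass G L' n z' := by
  refine HomologicalComplex.homologyMap_homologyClass ((S.constChainsFunctor G).map f)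
    _ (S.constChains_d_eq_zero G L n) _ (S.constChains_d_eq_zero G L' n) ?_
  refine S.chainsToFinsupp_injective G L' n ?_
  refine (S.chainsToFinsupp_constChainsMapX G (leOfHom f) n _).trans ?_
  refine (S.chainsToFinsupp_chainsEquivSupportedOn G L n _).trans ?_
  exact hz.trans (S.chainsToFinsupp_chainsEquivSupportedOn G L' n
    (AddSubgroup.inclusion inf_le_left z')).symm

end

end CellStructure

/-! ### Products, columns and the homology of the fibers -/

namespace CellStructure

theorem finsuppBoundary_finsuppBoundary {P : Type u} [PartialOrder P] (S : CellStructure P)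
    (G : AddCommGrpCat.{u}) (a : P →₀ G) : S.finsuppBoundary G (S.finsuppBoundary G a) = 0 := by
  classical
  suffices h : (S.finsuppBoundary G).comp (S.finsuppBoundary G) = 0 from DFunLike.congr_fun h a
  refine Finsupp.addHom_ext fun c g => ?_
  change S.finsuppBoundary G (S.finsuppBoundary G (single c g)) = 0
  rw [finsuppBoundary_single, map_sum]
  have key : ∀ c' ∈ S.faces c, S.finsuppBoundary G (S.inc c' c • single c' g) =
      ∑ c'' ∈ S.faces c, (S.inc c'' c' * S.inc c' c) • single c'' g := by
    intro c' hc'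
    rw [map_zsmul, finsuppBoundary_single, Finset.smul_sum]
    refine Finset.sum_subset_zero_on_sdiff (fun x hx =>
      S.mem_faces.2 ((S.mem_faces.1 hx).trans (S.mem_faces.1 hc'))) (fun x hx => ?_) fun x _ => ?_
    · have : S.inc x c' = 0 := by
        by_contra h0
        exact (Finset.mem_sdiff.1 hx).2 (S.mem_faces.2 (S.le_of_inc h0))
      rw [this, zero_mul, zero_smul]
    · rw [smul_smul, mul_comm]
  rw [Finset.sum_congr rfl key, Finset.sum_comm]
  refine Finset.sum_eq_zero fun c'' _ => ?_
  rw [← Finset.sum_smul, S.sum_inc_mul_inc, zero_smul]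

section Product

variable {P Q : Type u} (G : AddCommGrpCat.{u})

/-- The inclusion of the column over `σ`. -/
noncomputable def column (σ : P) : (Q →₀ G) →+ (P × Q →₀ G) :=
  mapDomain.addMonoidHom (Prod.mk σ)

/-- The inclusion of the row over `τ`. -/
noncomputable def row (τ : Q) : (P →₀ G) →+ (P × Q →₀ G) :=
  mapDomain.addMonoidHom fun σ => (σ, τ)

/-- The restriction to the column over `σ`. -/
noncomputable def toColumn (σ : P) : (P × Q →₀ G) →+ (Q →₀ G) :=
  (applyAddHom σ).comp curryAddEquiv.toAddMonoidHom

variable {G}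

theorem column_single (σ : P) (τ : Q) (g : G) : column G σ (single τ g) = single (σ, τ) g :=
  mapDomain_single

theorem row_single (σ : P) (τ : Q) (g : G) : row G τ (single σ g) = single (σ, τ) g :=
  mapDomain_single

theorem column_apply_self (σ : P) (τ : Q) (b : Q →₀ G) : column G σ b (σ, τ) = b τ :=
  mapDomain_apply (Prod.mk_right_injective σ) b τ

theorem column_apply_of_ne {σ σ' : P} (h : σ ≠ σ') (τ : Q) (b : Q →₀ G) :
    column G σ b (σ', τ) = 0 :=
  mapDomain_of_notMem_range _ _ (by rintro ⟨τ', h'⟩; exact h (congrArg Prod.fst h'))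

theorem toColumn_column (σ : P) (b : Q →₀ G) : toColumn G σ (column G σ b) = b :=
  Finsupp.ext fun τ => column_apply_self σ τ b

theorem toColumn_column_of_ne {σ σ' : P} (h : σ ≠ σ') (b : Q →₀ G) :
    toColumn G σ' (column G σ b) = 0 :=
  Finsupp.ext fun τ => column_apply_of_ne h τ b

theorem sum_column_toColumn (a : P × Q →₀ G) :
    ∑ σ ∈ a.curry.support, column G σ (toColumn G σ a) = a := by
  classical
  ext ⟨σ, τ⟩
  rw [Finsupp.finsetSum_apply, Finset.sum_eq_single σ]
  · rw [column_apply_self]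
    rfl
  · intro σ' _ h
    exact column_apply_of_ne h τ _
  · intro h
    rw [column_apply_self]
    exact DFunLike.congr_fun (notMem_support_iff.1 h) τ

variable [PartialOrder P] [PartialOrder Q] (S : CellStructure P) (T : CellStructure Q) (G)

/-- The boundary in the first factor, with signs depending on the dimension of the cell of the
second factor. -/
noncomputable def horizontalBoundary (s : ℕ → ℤˣ) : (P × Q →₀ G) →+ (P × Q →₀ G) :=
  liftAddHom fun c => (s (T.dim c.2) : ℤ) •
    (row G c.2).comp ((S.finsuppBoundary G).comp (singleAddHom c.1))

/-- The boundary in the second factor, with signs depending on the dimension of the cell of the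
first factor. -/
noncomputable def verticalBoundary (t : ℕ → ℤˣ) : (P × Q →₀ G) →+ (P × Q →₀ G) :=
  liftAddHom fun c => (t (S.dim c.1) : ℤ) •
    (column G c.1).comp ((T.finsuppBoundary G).comp (singleAddHom c.2))

variable {G} (s t : ℕ → ℤˣ)

theorem horizontalBoundary_row (τ : Q) (a : P →₀ G) :
    S.horizontalBoundary G T s (row G τ a) =
      (s (T.dim τ) : ℤ) • row G τ (S.finsuppBoundary G a) := by
  suffices h : (S.horizontalBoundary G T s).comp (row G τ) =
    (s (T.dim τ) : ℤ) • (row G τ).comp (S.finsuppBoundary G) from DFunLike.congr_fun h a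
  refine Finsupp.addHom_ext fun σ g => ?_
  refine (congrArg (S.horizontalBoundary G T s) (row_single σ τ g)).trans ?_
  exact liftAddHom_apply_single _ _ _

theorem verticalBoundary_column (σ : P) (a : Q →₀ G) :
    S.verticalBoundary G T t (column G σ a) =
      (t (S.dim σ) : ℤ) • column G σ (T.finsuppBoundary G a) := by
  suffices h : (S.verticalBoundary G T t).comp (column G σ) =
    (t (S.dim σ) : ℤ) • (column G σ).comp (T.finsuppBoundary G) from DFunLike.congr_fun h a
  refine Finsupp.addHom_ext fun τ g => ?_
  refine (congrArg (S.verticalBoundary G T t) (column_single σ τ g)).trans ?_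
  exact liftAddHom_apply_single _ _ _

theorem horizontalBoundary_single (σ : P) (τ : Q) (g : G) :
    S.horizontalBoundary G T s (single (σ, τ) g) =
      (s (T.dim τ) : ℤ) • ∑ σ' ∈ S.faces σ, S.inc σ' σ • single (σ', τ) g := by
  rw [← row_single, horizontalBoundary_row, finsuppBoundary_single, map_sum]
  simp only [map_zsmul, row_single]

theorem verticalBoundary_single (σ : P) (τ : Q) (g : G) :
    S.verticalBoundary G T t (single (σ, τ) g) =
      (t (S.dim σ) : ℤ) • ∑ τ' ∈ T.faces τ, T.inc τ' τ • single (σ, τ') g := by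
  rw [← column_single, verticalBoundary_column, finsuppBoundary_single, map_sum]
  simp only [map_zsmul, column_single]

theorem toColumn_verticalBoundary (σ : P) (a : P × Q →₀ G) :
    toColumn G σ (S.verticalBoundary G T t a) =
      (t (S.dim σ) : ℤ) • T.finsuppBoundary G (toColumn G σ a) := by
  suffices h : (toColumn G σ).comp (S.verticalBoundary G T t) =
    (t (S.dim σ) : ℤ) • (T.finsuppBoundary G).comp (toColumn G σ) from DFunLike.congr_fun h a
  refine Finsupp.addHom_ext fun c g => ?_
  obtain ⟨σ', τ⟩ := c
  change toColumn G σ (S.verticalBoundary G T t (single (σ', τ) g)) =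
    (t (S.dim σ) : ℤ) • T.finsuppBoundary G (toColumn G σ (single (σ', τ) g))
  rw [← column_single, verticalBoundary_column, map_zsmul]
  by_cases h : σ' = σ
  · subst h
    rw [toColumn_column, toColumn_column]
  · rw [toColumn_column_of_ne h, toColumn_column_of_ne h, map_zero, smul_zero, smul_zero]

/-- The sign depends only on the dimension in the second factor, which is constantly `q` on `a`;
hence whole columns are moved with one common sign. -/
theorem horizontalBoundary_column {q : ℕ} (σ : P) {a : Q →₀ G} {L : LowerSet Q}
    (ha : a ∈ supportedOn G (T.cells L q)) :
    S.horizontalBoundary G T s (column G σ a) =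
      (s q : ℤ) • ∑ σ' ∈ S.faces σ, S.inc σ' σ • column G σ' a := by
  suffices h : ((S.horizontalBoundary G T s).comp (column G σ) -
      (s q : ℤ) • ∑ σ' ∈ S.faces σ, S.inc σ' σ • column G σ' :
        (Q →₀ G) →+ (P × Q →₀ G)) a ∈ (⊥ : AddSubgroup _) by
    rw [AddSubgroup.mem_bot, AddMonoidHom.sub_apply, sub_eq_zero] at h
    refine h.trans ?_
    rw [AddMonoidHom.smul_apply, AddMonoidHom.finsetSum_apply]
    rfl
  refine map_mem_of_mem_supportedOn _ (fun τ hτ g => ?_) ha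
  rw [AddSubgroup.mem_bot, AddMonoidHom.sub_apply, sub_eq_zero, AddMonoidHom.smul_apply,
    AddMonoidHom.finsetSum_apply]
  change S.horizontalBoundary G T s (column G σ (single τ g)) =
    (s q : ℤ) • ∑ σ' ∈ S.faces σ, S.inc σ' σ • column G σ' (single τ g)
  rw [column_single, horizontalBoundary_single, hτ.2]
  simp only [column_single]

theorem horizontalBoundary_horizontalBoundary (a : P × Q →₀ G) :
    S.horizontalBoundary G T s (S.horizontalBoundary G T s a) = 0 := by
  suffices h : (S.horizontalBoundary G T s).comp (S.horizontalBoundary G T s) = 0 from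
    DFunLike.congr_fun h a
  refine Finsupp.addHom_ext fun c g => ?_
  obtain ⟨σ, τ⟩ := c
  change S.horizontalBoundary G T s (S.horizontalBoundary G T s (single (σ, τ) g)) = 0
  rw [← row_single, horizontalBoundary_row, map_zsmul, horizontalBoundary_row,
    finsuppBoundary_finsuppBoundary, map_zero, smul_zero, smul_zero]

theorem verticalBoundary_verticalBoundary (a : P × Q →₀ G) :
    S.verticalBoundary G T t (S.verticalBoundary G T t a) = 0 := by
  suffices h : (S.verticalBoundary G T t).comp (S.verticalBoundary G T t) = 0 from
    DFunLike.congr_fun h a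
  refine Finsupp.addHom_ext fun c g => ?_
  obtain ⟨σ, τ⟩ := c
  change S.verticalBoundary G T t (S.verticalBoundary G T t (single (σ, τ) g)) = 0
  rw [← column_single, verticalBoundary_column, map_zsmul, verticalBoundary_column,
    finsuppBoundary_finsuppBoundary, map_zero, smul_zero, smul_zero]

variable {s t} in
-- Along a nonzero pair of incidences the dimensions drop from `(p + 1, q + 1)` to `(p, q)`. The two
-- orders of traversal carry the signs `t (p + 1) * s q` and `s (q + 1) * t p`, which `hst` makes
-- opposite.
theorem horizontalBoundary_verticalBoundary (hst : ∀ p q, t (p + 1) * s q = -(s (q + 1) * t p))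
    (a : P × Q →₀ G) : S.horizontalBoundary G T s (S.verticalBoundary G T t a) =
      -S.verticalBoundary G T t (S.horizontalBoundary G T s a) := by
  suffices h : (S.horizontalBoundary G T s).comp (S.verticalBoundary G T t) =
      -(S.verticalBoundary G T t).comp (S.horizontalBoundary G T s) from DFunLike.congr_fun h a
  refine Finsupp.addHom_ext fun c g => ?_
  obtain ⟨σ, τ⟩ := c
  change S.horizontalBoundary G T s (S.verticalBoundary G T t (single (σ, τ) g)) =
    -S.verticalBoundary G T t (S.horizontalBoundary G T s (single (σ, τ) g))
  rw [verticalBoundary_single, horizontalBoundary_single]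
  simp only [map_zsmul, map_sum, verticalBoundary_single, horizontalBoundary_single,
    Finset.smul_sum, smul_smul]
  rw [Finset.sum_comm, ← Finset.sum_neg_distrib]
  refine Finset.sum_congr rfl fun σ' _ => ?_
  rw [← Finset.sum_neg_distrib]
  refine Finset.sum_congr rfl fun τ' _ => ?_
  rw [← neg_smul]
  congr 1
  by_cases h1 : S.inc σ' σ = 0
  · simp [h1]
  by_cases h2 : T.inc τ' τ = 0
  · simp [h2]
  have h3 := congrArg Units.val (hst (S.dim σ') (T.dim τ'))
  push_cast at h3
  rw [S.dim_of_inc h1, T.dim_of_inc h2]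
  linear_combination (T.inc τ' τ * S.inc σ' σ) * h3

variable (G)

/-- The double complex of a subcomplex of a product. -/
noncomputable def doubleComplex (R : LowerSet (P × Q))
    (hst : ∀ p q, t (p + 1) * s q = -(s (q + 1) * t p)) : BasedDoubleComplex (P × Q) G where
  x c := S.dim c.1
  y c := T.dim c.2
  L := R
  dh := S.horizontalBoundary G T s
  dv := S.verticalBoundary G T t
  dh_single := by
    rintro ⟨σ, τ⟩ hc g
    rw [horizontalBoundary_single]
    refine zsmul_mem (sum_mem fun σ' hσ' => ?_) _
    by_cases h : S.inc σ' σ = 0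
    · rw [h, zero_smul]
      exact zero_mem _
    · exact zsmul_mem (single_mem_supportedOn (c := (σ', τ)) (s := {c' | c' ∈ R ∧
        S.dim σ = S.dim c'.1 + 1 ∧ T.dim c'.2 = T.dim τ})
        ⟨R.lower (Prod.mk_le_mk.2 ⟨S.le_of_inc h, le_rfl⟩) hc, S.dim_of_inc h, rfl⟩ g) _
  dv_single := by
    rintro ⟨σ, τ⟩ hc g
    rw [verticalBoundary_single]
    refine zsmul_mem (sum_mem fun τ' hτ' => ?_) _
    by_cases h : T.inc τ' τ = 0
    · rw [h, zero_smul]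
      exact zero_mem _
    · exact zsmul_mem (single_mem_supportedOn (c := (σ, τ')) (s := {c' | c' ∈ R ∧
        S.dim c'.1 = S.dim σ ∧ T.dim τ = T.dim c'.2 + 1})
        ⟨R.lower (Prod.mk_le_mk.2 ⟨le_rfl, T.le_of_inc h⟩) hc, rfl, T.dim_of_inc h⟩ g) _
  dh_dh := S.horizontalBoundary_horizontalBoundary T s
  dv_dv := S.verticalBoundary_verticalBoundary T t
  dh_dv := S.horizontalBoundary_verticalBoundary T hst

variable {G} {s t} (R : LowerSet (P × Q)) (hst : ∀ p q, t (p + 1) * s q = -(s (q + 1) * t p))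

/-- The subcomplex of the second factor related to a cell of the first factor. -/
abbrev fiber (σ : P) : LowerSet Q := (relatedRight R).obj (Opposite.op σ)

variable {S T R hst} {p q : ℕ}

theorem mem_part_doubleComplex {a : P × Q →₀ G} :
    a ∈ (S.doubleComplex G T s t R hst).part p q ↔
      ∀ c, a c ≠ 0 → c ∈ R ∧ S.dim c.1 = p ∧ T.dim c.2 = q := by
  refine forall_congr' fun c => forall_congr' fun _ => ?_
  change (c ∈ R ∧ (S.dim c.1 : ℤ) = p ∧ (T.dim c.2 : ℤ) = q) ↔ _
  simp

theorem toColumn_mem_cells {a : P × Q →₀ G} (ha : a ∈ (S.doubleComplex G T s t R hst).part p q)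
    (σ : P) : toColumn G σ a ∈ supportedOn G (T.cells (fiber R σ) q) := fun τ hτ => by
  obtain ⟨h1, h2, h3⟩ := mem_part_doubleComplex.1 ha (σ, τ) hτ
  exact ⟨h1, h3⟩

theorem column_mem_part {σ : P} (hσ : S.dim σ = p) {b : Q →₀ G}
    (hb : b ∈ supportedOn G (T.cells (fiber R σ) q)) :
    column G σ b ∈ (S.doubleComplex G T s t R hst).part p q := by
  refine mem_part_doubleComplex.2 fun c hc => ?_
  obtain ⟨σ', τ⟩ := c
  by_cases h : σ = σ'
  · subst h
    rw [column_apply_self] at hc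
    exact ⟨(hb τ hc).1, hσ, (hb τ hc).2⟩
  · exact absurd (column_apply_of_ne h τ b) hc

theorem units_smul_eq_zero_iff {B : Type*} [AddCommGroup B] (ε : ℤˣ) (b : B) :
    (ε : ℤ) • b = 0 ↔ b = 0 := by
  rcases Int.units_eq_one_or ε with rfl | rfl <;> simp

theorem units_smul_smul {B : Type*} [AddCommGroup B] (ε : ℤˣ) (b : B) :
    (ε : ℤ) • (ε : ℤ) • b = b := by
  rcases Int.units_eq_one_or ε with rfl | rfl <;> simp

theorem toColumn_mem_cellCycles {a : P × Q →₀ G}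
    (ha : a ∈ (S.doubleComplex G T s t R hst).verticalCycles p q) (σ : P) :
    toColumn G σ a ∈ T.cellCycles G (fiber R σ) q := by
  refine mem_cellCycles.2 ⟨toColumn_mem_cells ha.1 σ, ?_⟩
  have h : S.verticalBoundary G T t a = 0 := ha.2
  rw [← units_smul_eq_zero_iff (t (S.dim σ)), ← toColumn_verticalBoundary, h, map_zero]

theorem column_mem_verticalCycles {σ : P} (hσ : S.dim σ = p) {b : Q →₀ G}
    (hb : b ∈ T.cellCycles G (fiber R σ) q) :
    column G σ b ∈ (S.doubleComplex G T s t R hst).verticalCycles p q := by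
  refine BasedDoubleComplex.mem_verticalCycles.2 ⟨column_mem_part hσ hb.1, ?_⟩
  refine (S.verticalBoundary_column T t σ b).trans ?_
  rw [(mem_cellCycles.1 hb).2, map_zero, smul_zero]

variable (G) (T R q) in
/-- The cosheaf of homology groups of the fibers. -/
noncomputable abbrev fiberHomology : Pᵒᵖ ⥤ AddCommGrpCat.{u} :=
  relatedRight R ⋙ T.subcomplexHomology G q

variable (T R q) in
/-- The homology class of a cycle of a fiber. -/
noncomputable abbrev fiberClass (σ : P) :
    T.cellCycles G (fiber R σ) q →+ (T.fiberHomology G R q).obj (Opposite.op σ) :=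
  T.cycleClass G (fiber R σ) q

theorem fiberClass_eq_zero {σ : P} {z : T.cellCycles G (fiber R σ) q} (h : z.1 = 0) :
    T.fiberClass R q σ z = 0 := by
  rw [show z = 0 from Subtype.ext h, map_zero]

/-- The family of the classes of the columns of a vertical cycle. -/
noncomputable def columnClasses (a : (S.doubleComplex G T s t R hst).verticalCycles p q) :
    Π₀ σ : {σ : P // S.dim σ = p}, (T.fiberHomology G R q).obj (Opposite.op σ.1) :=
  open Classical in DFinsupp.mk (a.1.curry.support.subtype fun σ => S.dim σ = p)
    fun σ => T.fiberClass R q σ.1.1 ⟨_, toColumn_mem_cellCycles a.2 σ.1.1⟩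

theorem columnClasses_apply (a : (S.doubleComplex G T s t R hst).verticalCycles p q)
    (σ : {σ : P // S.dim σ = p}) :
    columnClasses a σ = T.fiberClass R q σ.1 ⟨_, toColumn_mem_cellCycles a.2 σ.1⟩ := by
  classical
  rw [columnClasses, DFinsupp.mk_apply]
  split_ifs with h
  · rfl
  · rw [Finset.mem_subtype, notMem_support_iff] at h
    exact (fiberClass_eq_zero h).symm

variable (S T R hst p q)

open Classical in
/-- The class of a vertical cycle in the direct sum of the homology groups of the fibers. -/
noncomputable def verticalClass : (S.doubleComplex G T s t R hst).verticalCycles p q →+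
    (S.chains (T.fiberHomology G R q) p : AddCommGrpCat.{u}) :=
  (S.chainsEquiv (T.fiberHomology G R q) p).symm.toAddMonoidHom.comp
    { toFun := columnClasses
      map_zero' := DFinsupp.ext fun σ => by
        rw [columnClasses_apply]
        exact fiberClass_eq_zero (map_zero (toColumn G σ.1))
      map_add' a b := DFinsupp.ext fun σ => by
        rw [DFinsupp.add_apply, columnClasses_apply, columnClasses_apply, columnClasses_apply,
          ← map_add]
        exact congrArg _ (Subtype.ext (map_add (toColumn G σ.1) a.1 b.1)) }

variable {S T R hst p q}

open Classical in
theorem chainsEquiv_verticalClass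
    (a : (S.doubleComplex G T s t R hst).verticalCycles p q) :
    S.chainsEquiv (T.fiberHomology G R q) p (S.verticalClass T R hst p q a) = columnClasses a := by
  exact (S.chainsEquiv (T.fiberHomology G R q) p).apply_symm_apply (columnClasses a)

theorem verticalClass_column {σ : P} (hσ : S.dim σ = p) {b : Q →₀ G}
    (hb : b ∈ T.cellCycles G (fiber R σ) q) :
    S.verticalClass T R hst p q ⟨_, column_mem_verticalCycles hσ hb⟩ =
      S.ιChains (T.fiberHomology G R q) p σ (T.fiberClass R q σ ⟨b, hb⟩) := by
  classical
  refine (S.chainsEquiv (T.fiberHomology G R q) p).injective ?_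
  rw [chainsEquiv_verticalClass, chainsEquiv_ιChains _ hσ]
  refine DFinsupp.ext fun σ' => ?_
  rw [columnClasses_apply]
  by_cases h : (⟨σ, hσ⟩ : {σ : P // S.dim σ = p}) = σ'
  · subst h
    rw [DFinsupp.single_eq_same]
    exact congrArg (T.fiberClass R q σ) (Subtype.ext (toColumn_column σ b))
  · rw [DFinsupp.single_eq_of_ne (Ne.symm h)]
    exact fiberClass_eq_zero (toColumn_column_of_ne (fun h' => h (Subtype.ext h')) b)

theorem verticalClass_surjective : Function.Surjective
    (S.verticalClass (G := G) T R hst p q) := by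
  intro x
  refine S.mem_of_ιChains_mem (S.verticalClass T R hst p q).range (fun σ hσ y => ?_) x
  obtain ⟨z, rfl⟩ := T.cycleClass_surjective G (fiber R σ) q y
  exact ⟨_, verticalClass_column hσ z.2⟩

/-- The columns do not interact under `dv`: a vertical cycle bounds exactly when each of its
finitely many nonzero columns bounds in its own fiber. -/
theorem verticalClass_eq_zero_iff (z : (S.doubleComplex G T s t R hst).verticalCycles p q) :
    S.verticalClass T R hst p q z = 0 ↔
      ∃ b ∈ (S.doubleComplex G T s t R hst).part p (q + 1),
        (S.doubleComplex G T s t R hst).dv b = z := by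
  classical
  rw [← (S.chainsEquiv (T.fiberHomology G R q) p).map_eq_zero_iff, chainsEquiv_verticalClass]
  constructor
  · intro h
    have h1 : ∀ σ, ∃ b, S.dim σ = p → b ∈ supportedOn G (T.cells (fiber R σ) (q + 1)) ∧
        T.finsuppBoundary G b = toColumn G σ z.1 := by
      intro σ
      by_cases hσ : S.dim σ = p
      · have h2 := DFunLike.congr_fun h ⟨σ, hσ⟩
        rw [columnClasses_apply] at h2
        obtain ⟨b, hb, hbz⟩ := (T.cycleClass_eq_zero_iff G (fiber R σ) q _).1 h2
        exact ⟨b, fun _ => ⟨hb, hbz⟩⟩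
      · exact ⟨0, fun h => absurd h hσ⟩
    choose b hb using h1
    have hdim : ∀ σ ∈ z.1.curry.support, S.dim σ = p := by
      intro σ hσ
      obtain ⟨τ, hτ⟩ := DFunLike.ne_iff.1 (mem_support_iff.1 hσ)
      exact (mem_part_doubleComplex.1 z.2.1 (σ, τ) hτ).2.1
    -- The factor `t (dim σ)` compensates the sign of the vertical boundary on the column over `σ`,
    -- as its square is one.
    refine ⟨∑ σ ∈ z.1.curry.support, (t (S.dim σ) : ℤ) • column G σ (b σ),
      sum_mem fun σ hσ => zsmul_mem ?_ _, ?_⟩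
    · have := column_mem_part (hst := hst) (hdim σ hσ) (hb σ (hdim σ hσ)).1
      rwa [Nat.cast_add, Nat.cast_one] at this
    · change S.verticalBoundary G T t _ = z.1
      rw [map_sum]
      refine Eq.trans (Finset.sum_congr rfl fun σ hσ => ?_) (sum_column_toColumn z.1)
      rw [map_zsmul, verticalBoundary_column, units_smul_smul, (hb σ (hdim σ hσ)).2]
  · rintro ⟨b, hb, hbz⟩
    refine DFinsupp.ext fun σ => ?_
    rw [columnClasses_apply]
    refine (T.cycleClass_eq_zero_iff G (fiber R σ.1) q _).2 ?_
    have hb' : b ∈ (S.doubleComplex G T s t R hst).part p (q + 1 : ℕ) := by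
      rwa [Nat.cast_add, Nat.cast_one]
    refine ⟨(t (S.dim σ.1) : ℤ) • toColumn G σ.1 b, zsmul_mem (toColumn_mem_cells hb' σ.1) _, ?_⟩
    rw [map_zsmul, ← toColumn_verticalBoundary]
    exact congrArg _ hbz

/-- Homomorphisms on vertical cycles agree if they agree on cycles concentrated in one column. -/
theorem verticalCycles_hom_ext {B : Type*} [AddCommGroup B]
    {f g : (S.doubleComplex G T s t R hst).verticalCycles p q →+ B}
    (h : ∀ σ (hσ : S.dim σ = p) b (hb : b ∈ T.cellCycles G (fiber R σ) q),
      f ⟨_, column_mem_verticalCycles hσ hb⟩ = g ⟨_, column_mem_verticalCycles hσ hb⟩) :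
    f = g := by
  refine AddMonoidHom.ext fun z => ?_
  have hdim : ∀ σ ∈ z.1.curry.support, S.dim σ = p := by
    intro σ hσ
    obtain ⟨τ, hτ⟩ := DFunLike.ne_iff.1 (mem_support_iff.1 hσ)
    exact (mem_part_doubleComplex.1 z.2.1 (σ, τ) hτ).2.1
  have hz : z = ∑ σ ∈ z.1.curry.support.attach, ⟨_, column_mem_verticalCycles (hdim σ.1 σ.2)
      (toColumn_mem_cellCycles z.2 σ.1)⟩ := by
    refine Subtype.ext ?_
    rw [AddSubgroup.val_finsetSum]
    refine (sum_column_toColumn z.1).symm.trans ?_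
    exact (Finset.sum_attach z.1.curry.support
      fun σ => column G σ (toColumn G σ z.1)).symm
  rw [hz, map_sum, map_sum]
  exact Finset.sum_congr rfl fun σ _ =>
    h σ.1 (hdim σ.1 σ.2) _ (toColumn_mem_cellCycles z.2 σ.1)

/-- For one column the horizontal boundary copies the same cycle `b` to the faces `σ'`, with the
common sign `s q`. Its class in the fiber over `σ'` is the image of its class over `σ` under the
extension map. -/
theorem boundary_verticalClass (z : (S.doubleComplex G T s t R hst).verticalCycles (p + 1 : ℕ) q)
    (z' : (S.doubleComplex G T s t R hst).verticalCycles p q)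
    (h : (S.doubleComplex G T s t R hst).dh z.1 = z'.1) :
    S.boundary (T.fiberHomology G R q) p (S.verticalClass T R hst (p + 1) q z) =
      (s q : ℤ) • S.verticalClass T R hst p q z' := by
  let δ : (S.doubleComplex G T s t R hst).verticalCycles (p + 1 : ℕ) q →+
      (S.doubleComplex G T s t R hst).verticalCycles p q :=
    ((S.doubleComplex G T s t R hst).dh.comp (AddSubgroup.subtype _)).codRestrict _ fun z =>
      BasedDoubleComplex.dh_mem_verticalCycles z.2 (by simp)
  rw [show z' = δ z from Subtype.ext h.symm]
  suffices key : (S.boundary (T.fiberHomology G R q) p).hom.comp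
      (S.verticalClass T R hst (p + 1) q) = (s q : ℤ) • (S.verticalClass T R hst p q).comp δ from
    DFunLike.congr_fun key z
  refine verticalCycles_hom_ext fun σ hσ b hb => ?_
  have hb' : ∀ σ' ∈ S.faces σ, b ∈ T.cellCycles G (fiber R σ') q := fun σ' hσ' =>
    cellCycles_mono (leOfHom ((relatedRight R).map (homOfLE (S.mem_faces.1 hσ')).op)) hb
  have hdim : ∀ σ', S.inc σ' σ ≠ 0 → S.dim σ' = p := fun σ' h0 => by
    have := S.dim_of_inc h0
    omega
  -- A face of codimension other than one has its column outside first degree `p`, so membership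
  -- holds only after multiplication by the incidence number, which is then zero.
  have hmem : ∀ σ' ∈ S.faces σ, S.inc σ' σ • column G σ' b ∈
      (S.doubleComplex G T s t R hst).verticalCycles p q := by
    intro σ' hσ'
    by_cases h0 : S.inc σ' σ = 0
    · rw [h0, zero_smul]
      exact zero_mem _
    · exact zsmul_mem (column_mem_verticalCycles (hdim σ' h0) (hb' σ' hσ')) _
  have hδ : δ ⟨_, column_mem_verticalCycles hσ hb⟩ =
      (s q : ℤ) • ∑ σ' ∈ (S.faces σ).attach, ⟨_, hmem σ'.1 σ'.2⟩ := by
    refine Subtype.ext ?_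
    rw [AddSubgroup.coe_zsmul, AddSubgroup.val_finsetSum]
    refine (S.horizontalBoundary_column T s σ hb.1).trans ?_
    exact congrArg _ (Finset.sum_attach (S.faces σ) fun σ' => S.inc σ' σ • column G σ' b).symm
  change S.boundary (T.fiberHomology G R q) p (S.verticalClass T R hst (p + 1) q _) =
    (s q : ℤ) • S.verticalClass T R hst p q (δ _)
  -- The sign `s q` of the horizontal boundary cancels against the one in the statement.
  rw [hδ, map_zsmul, units_smul_smul, map_sum, verticalClass_column hσ hb,
    boundary_ιChains_apply, ← Finset.sum_attach]
  refine Finset.sum_congr rfl fun σ' _ => ?_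
  by_cases h0 : S.inc σ'.1 σ = 0
  · have e : (⟨_, hmem σ'.1 σ'.2⟩ : (S.doubleComplex G T s t R hst).verticalCycles p q) = 0 :=
      Subtype.ext ((congrArg (· • column G σ'.1 b) h0).trans (zero_smul ℤ _))
    rw [e, map_zero, h0, zero_smul]
  · have e : (⟨_, hmem σ'.1 σ'.2⟩ : (S.doubleComplex G T s t R hst).verticalCycles p q) =
        S.inc σ'.1 σ • ⟨_, column_mem_verticalCycles (hdim σ'.1 h0) (hb' σ'.1 σ'.2)⟩ := rfl
    rw [e, map_zsmul, verticalClass_column (hdim σ'.1 h0) (hb' σ'.1 σ'.2),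
      extensionMap_of_le _ (S.mem_faces.1 σ'.2)]
    refine congrArg (fun x => S.inc σ'.1 σ • S.ιChains (T.fiberHomology G R q) p σ'.1 x) ?_
    exact T.subcomplexHomology_map_cycleClass G _ q (z' := ⟨b, hb' σ'.1 σ'.2⟩) rfl

variable (S T R hst) in
/-- The second page of the spectral sequence of the double complex of a subcomplex of a product
is the homology of the cosheaf of homology groups of the fibers. -/
theorem nonempty_pageX_two_equiv_cosheafHomology (p q : ℕ) (n : ℤ) (hn : (p : ℤ) + q = n) :
    Nonempty ((S.doubleComplex G T s t R hst).total.pageX 2 p n ≃+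
      (S.cosheafHomology (T.fiberHomology G R q) p : AddCommGrpCat.{u})) := by
  refine BasedDoubleComplex.nonempty_pageX_two_equiv q (S.chainComplex (T.fiberHomology G R q))
    (fun p => S.verticalClass T R hst p q) (fun p => verticalClass_surjective)
    (fun p => verticalClass_eq_zero_iff) (fun p z z' h => ?_) p n hn
  have h1 := boundary_verticalClass z z' h
  rw [S.chainComplex_d]
  rcases Int.units_eq_one_or (s q) with hs | hs
  · left
    rw [hs] at h1
    exact h1.trans (one_smul _ _)
  · right
    rw [hs] at h1
    exact h1.trans (neg_one_smul _ _)

end Product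

end CellStructure

/-! ### Quadrant indexing and convergence -/

namespace FilteredDifferential

/-- The indexing by first quadrant positions filtered by the first degree. -/
def columnIndexing : Indexing (fun r => ComplexShape.spectralSequenceNat (-r, r - 1)) where
  filt k := k.1
  deg k := k.1 + k.2
  rel_iff r a b := by
    rw [ComplexShape.spectralSequenceNat_rel_iff]
    constructor <;> rintro ⟨h1, h2⟩ <;> constructor <;> lia
  exists_index p n hp hn := ⟨(p.toNat, (n - p).toNat), by lia, by lia⟩
  filt_le k := by lia
  filt_nonneg k := by lia

/-- The indexing by first quadrant positions filtered by the second degree. -/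
def rowIndexing : Indexing (fun r => ComplexShape.spectralSequenceNat (r - 1, -r)) where
  filt k := k.2
  deg k := k.2 + k.1
  rel_iff r a b := by
    rw [ComplexShape.spectralSequenceNat_rel_iff]
    constructor <;> rintro ⟨h1, h2⟩ <;> constructor <;> lia
  exists_index p n hp hn := ⟨((n - p).toNat, p.toNat), by lia, by lia⟩
  filt_le k := by lia
  filt_nonneg k := by lia

theorem spectralSequenceConvergesTo {A : Type u} [AddCommGroup A] (D : FilteredDifferential A)
    {d : ℤ → ℤ × ℤ} (I : Indexing (fun r => ComplexShape.spectralSequenceNat (d r)))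
    (s : ℕ × ℕ → ℕ) (hs : ∀ k, I.filt k = s k) (hdeg : ∀ p q, I.deg (p, q) = (p + q : ℕ))
    (H : ℕ → AddCommGrpCat.{u}) (π : ∀ n : ℕ, D.cycles n →+ H n)
    (hπ : ∀ n, Function.Surjective (π n))
    (hker : ∀ n z, π n z = 0 ↔ ∃ b ∈ D.F (n + 1) (n + 1), D.d b = z) :
    SpectralSequenceConvergesTo (D.spectralSequence I) s H := by
  intro n
  obtain ⟨Φ, h1, h2, h3, h4⟩ := D.exists_filtration n (π n) (hπ n) (hker n)
  refine ⟨Φ, h1, h2, h3, fun p q hpq r hr => ?_⟩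
  subst hpq
  have hle := I.filt_le (p, q)
  rw [hs, hdeg] at hle
  have := h4 (s (p, q)) r hr (by lia)
  rw [← hs, ← hdeg] at this
  exact this

end FilteredDifferential

namespace BasedDoubleComplex

/-- The spectral sequence of a double complex converges to the homology of a subcomplex of a cell
complex whose chains are identified with the total complex. -/
theorem spectralSequenceConvergesTo {ι : Type u} {G : AddCommGrpCat.{u}}
    (D : BasedDoubleComplex ι G) {d : ℤ → ℤ × ℤ}
    (I : FilteredDifferential.Indexing (fun r => ComplexShape.spectralSequenceNat (d r)))
    (s : ℕ × ℕ → ℕ) (hs : ∀ k, I.filt k = s k) (hdeg : ∀ p q, I.deg (p, q) = (p + q : ℕ))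
    {P : Type u} [PartialOrder P] (S : CellStructure P) (L : LowerSet P)
    (e : (P →₀ G) ≃+ (ι →₀ G))
    (he : ∀ a, e (S.finsuppBoundary G a) = D.dh (e a) + D.dv (e a))
    (hsupp : ∀ (n : ℕ) a, e a ∈ D.filt n n ↔ a ∈ supportedOn G (S.cells L n)) :
    SpectralSequenceConvergesTo (D.total.spectralSequence I) s
      fun n => (S.subcomplexHomology G n).obj L := by
  have hsymm : ∀ a, S.finsuppBoundary G (e.symm a) = e.symm (D.dh a + D.dv a) := by
    intro a
    rw [AddEquiv.eq_symm_apply, he, e.apply_symm_apply]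
  have hmem : ∀ (n : ℕ) (z : D.total.cycles n), e.symm z.1 ∈ S.cellCycles G L n := by
    intro n z
    refine CellStructure.mem_cellCycles.2 ⟨(hsupp n _).1 ?_, ?_⟩
    · rw [e.apply_symm_apply]
      exact z.2.1
    · rw [hsymm, show D.dh z.1 + D.dv z.1 = 0 from z.2.2, map_zero]
  refine D.total.spectralSequenceConvergesTo I s hs hdeg _
    (fun n => (S.cycleClass G L n).comp
      ((e.symm.toAddMonoidHom.comp (D.total.cycles n).subtype).codRestrict _ (hmem n)))
    (fun n x => ?_) fun n z => ?_
  · obtain ⟨z, rfl⟩ := S.cycleClass_surjective G L n x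
    obtain ⟨h1, h2⟩ := CellStructure.mem_cellCycles.1 z.2
    refine ⟨⟨e z.1, FilteredDifferential.mem_cycles.2 ⟨(hsupp n _).2 h1, ?_⟩⟩, ?_⟩
    · exact (he z.1).symm.trans (by rw [h2, map_zero])
    · exact congrArg (S.cycleClass G L n) (Subtype.ext (e.symm_apply_apply z.1))
  · refine (S.cycleClass_eq_zero_iff G L n _).trans ?_
    constructor
    · rintro ⟨b, hb, hbz⟩
      refine ⟨e b, by exact_mod_cast (hsupp (n + 1) b).2 hb, ?_⟩
      refine (he b).symm.trans ?_
      rw [hbz]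
      exact e.apply_symm_apply z.1
    · rintro ⟨b, hb, hbz⟩
      refine ⟨e.symm b, (hsupp (n + 1) _).1 ?_, ?_⟩
      · rw [e.apply_symm_apply]
        exact_mod_cast hb
      · rw [hsymm]
        exact congrArg e.symm hbz

end BasedDoubleComplex

/-! ### The two spectral sequences of a subcomplex of a product -/

namespace CellStructure

variable {P Q : Type u} [PartialOrder P] [PartialOrder Q] (S : CellStructure P)
  (T : CellStructure Q) (G : AddCommGrpCat.{u})

theorem finsuppBoundary_prod_single (σ : P) (τ : Q) (g : G) :
    (S.prod T).finsuppBoundary G (single (σ, τ) g) =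
      ∑ σ' ∈ S.faces σ, S.inc σ' σ • single (σ', τ) g +
        (-1 : ℤ) ^ S.dim σ • ∑ τ' ∈ T.faces τ, T.inc τ' τ • single (σ, τ') g := by
  classical
  rw [finsuppBoundary_single]
  change ∑ c' ∈ S.faces σ ×ˢ T.faces τ, (_ : ℤ) • _ = _
  rw [Finset.sum_product]
  have key : ∀ σ' τ', (S.prod T).inc (σ', τ') (σ, τ) =
      (if τ' = τ then S.inc σ' σ else 0) +
        (if σ' = σ then (-1) ^ S.dim σ * T.inc τ' τ else 0) := by
    intro σ' τ'
    change (if _ then _ else _) + (if _ then _ else _) = _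
    congr
  simp only [key, add_smul, Finset.sum_add_distrib, ite_smul, zero_smul]
  congr 1
  · refine Finset.sum_congr rfl fun σ' _ => ?_
    rw [Finset.sum_ite_eq' (T.faces τ) τ, if_pos (T.mem_faces.2 le_rfl)]
  · rw [Finset.sum_comm, Finset.smul_sum]
    refine Finset.sum_congr rfl fun τ' _ => ?_
    rw [Finset.sum_ite_eq' (S.faces σ) σ, if_pos (S.mem_faces.2 le_rfl), mul_smul]

/-- The subcomplex of the product with exchanged factors. -/
def swapLowerSet (R : LowerSet (P × Q)) : LowerSet (Q × P) where
  carrier := {c | c.swap ∈ R}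
  lower' _ _ h hR := R.lower (Prod.swap_le_swap.2 h) hR

/-- The first spectral sequence of a subcomplex of a product. -/
theorem exists_columnSpectralSequence (R : LowerSet (P × Q)) :
    ∃ E : ColumnSpectralSequence.{u},
      (∀ p q : ℕ, Nonempty ((E.page 2 le_rfl).X (p, q) ≅
        S.cosheafHomology (relatedRight R ⋙ T.subcomplexHomology G q) p)) ∧
      SpectralSequenceConvergesTo E Prod.fst
        fun n => ((S.prod T).subcomplexHomology G n).obj R := by
  have hst : ∀ p q : ℕ, (-1 : ℤˣ) ^ (p + 1) * 1 = -(1 * (-1) ^ p) := fun p q => by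
    rw [pow_succ, mul_one, mul_neg_one, one_mul]
  -- With these signs the total differential is the boundary of the product.
  let D := S.doubleComplex G T (fun _ => 1) (fun p => (-1) ^ p) R hst
  refine ⟨D.total.spectralSequence FilteredDifferential.columnIndexing, fun p q => ?_, ?_⟩
  · obtain ⟨f⟩ := S.nonempty_pageX_two_equiv_cosheafHomology (G := G) T R hst p q _ rfl
    exact ⟨f.toAddCommGrpIso⟩
  · refine D.spectralSequenceConvergesTo _ _ (fun _ => rfl) (fun p q => (Nat.cast_add p q).symm)
      (S.prod T) R (AddEquiv.refl _) (fun a => ?_) fun n a => ?_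
    · suffices h : (S.prod T).finsuppBoundary G = D.dh + D.dv from DFunLike.congr_fun h a
      refine Finsupp.addHom_ext fun c g => ?_
      refine (S.finsuppBoundary_prod_single T G c.1 c.2 g).trans ?_
      refine Eq.trans ?_ (congrArg₂ (· + ·) (S.horizontalBoundary_single T (fun _ => 1) c.1 c.2 g)
        (S.verticalBoundary_single T (fun p => (-1) ^ p) c.1 c.2 g)).symm
      simp
    · refine forall_congr' fun c => forall_congr' fun _ => ?_
      change (c ∈ R ∧ (S.dim c.1 : ℤ) + T.dim c.2 = n ∧ (S.dim c.1 : ℤ) ≤ n) ↔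
        c ∈ R ∧ S.dim c.1 + T.dim c.2 = n
      refine and_congr_right fun _ => ?_
      lia

/-- The second spectral sequence of a subcomplex of a product. -/
theorem exists_rowSpectralSequence (R : LowerSet (P × Q)) :
    ∃ E : RowSpectralSequence.{u},
      (∀ p q : ℕ, Nonempty ((E.page 2 le_rfl).X (p, q) ≅
        T.cosheafHomology (relatedLeft R ⋙ S.subcomplexHomology G p) q)) ∧
      SpectralSequenceConvergesTo E Prod.snd
        fun n => ((S.prod T).subcomplexHomology G n).obj R := by
  have hst : ∀ p q : ℕ, (1 : ℤˣ) * (-1) ^ q = -((-1) ^ (q + 1) * 1) := fun p q => by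
    rw [pow_succ, mul_one, mul_neg_one, one_mul, neg_neg]
  -- After the exchange the horizontal direction is that of `τ`, so it carries the sign `(-1) ^ dim
  -- σ` and the vertical one carries none: the total differential is still the product boundary, now
  -- filtered by `dim τ`.
  let D := T.doubleComplex G S (fun p => (-1) ^ p) (fun _ => 1) (swapLowerSet R) hst
  refine ⟨D.total.spectralSequence FilteredDifferential.rowIndexing, fun p q => ?_, ?_⟩
  · obtain ⟨f⟩ := T.nonempty_pageX_two_equiv_cosheafHomology (G := G) (s := fun p => (-1) ^ p)
      (t := fun _ => 1) S (swapLowerSet R) hst q p _ rfl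
    exact ⟨f.toAddCommGrpIso⟩
  · refine D.spectralSequenceConvergesTo _ _ (fun _ => rfl)
      (fun p q => by rw [add_comm p q]; exact (Nat.cast_add q p).symm)
      (S.prod T) R (Finsupp.domCongr (Equiv.prodComm P Q)) (fun a => ?_) fun n a => ?_
    · suffices h : (Finsupp.domCongr (Equiv.prodComm P Q)).toAddMonoidHom.comp
          ((S.prod T).finsuppBoundary G) =
          (D.dh + D.dv).comp (Finsupp.domCongr (Equiv.prodComm P Q)).toAddMonoidHom from
        DFunLike.congr_fun h a
      have hsingle : ∀ c (g : G), Finsupp.domCongr (Equiv.prodComm P Q) (single c g) =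
          single c.swap g := fun c g => equivMapDomain_single _ _ _
      refine Finsupp.addHom_ext fun c g => ?_
      refine (congrArg (Finsupp.domCongr (Equiv.prodComm P Q))
        (S.finsuppBoundary_prod_single T G c.1 c.2 g)).trans ?_
      refine Eq.trans ?_ (congrArg (D.dh + D.dv) (hsingle c g)).symm
      refine Eq.trans ?_ (congrArg₂ (· + ·)
        (T.horizontalBoundary_single S (fun p => (-1) ^ p) c.2 c.1 g)
        (T.verticalBoundary_single S (fun _ => 1) c.2 c.1 g)).symm
      simp only [map_add, map_sum, map_zsmul, hsingle, Prod.swap_prod_mk]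
      -- The swap exchanges the roles of horizontal and vertical, hence the order of the two
      -- summands.
      rw [add_comm]
      simp
    · have h1 : ∀ c, Finsupp.domCongr (Equiv.prodComm P Q) a c = a c.swap := fun c => rfl
      rw [mem_supportedOn, BasedDoubleComplex.filt, mem_supportedOn, Prod.swap_surjective.forall]
      refine forall_congr' fun c => ?_
      rw [h1, Prod.swap_swap]
      refine forall_congr' fun _ => ?_
      change (c.swap.swap ∈ R ∧ (T.dim c.2 : ℤ) + S.dim c.1 = n ∧ (T.dim c.2 : ℤ) ≤ n) ↔
        c ∈ R ∧ S.dim c.1 + T.dim c.2 = n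
      rw [Prod.swap_swap]
      refine and_congr_right fun _ => ?_
      lia

end CellStructure

theorem theorem4p2 {V W : Type u} [LinearOrder V] [LinearOrder W]
    (K : PreAbstractSimplicialComplex V) (M : PreAbstractSimplicialComplex W)
    (R : LowerSet (K × M)) (G : AddCommGrpCat.{u}) :
    (∃ E : ColumnSpectralSequence.{u},
      (∀ p q : ℕ, Nonempty ((E.page 2).X (p, q) ≅
        K.cellStructure.cosheafHomology (RelationalComplex.cosheafK K M R G q) p)) ∧
      SpectralSequenceConvergesTo E Prod.fst (RelationalComplex.productHomology K M R G)) ∧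
    (∃ E : RowSpectralSequence.{u},
      (∀ p q : ℕ, Nonempty ((E.page 2).X (p, q) ≅
        M.cellStructure.cosheafHomology (RelationalComplex.cosheafM K M R G p) q)) ∧
      SpectralSequenceConvergesTo E Prod.snd (RelationalComplex.productHomology K M R G)) :=
  ⟨K.cellStructure.exists_columnSpectralSequence M.cellStructure G R,
    K.cellStructure.exists_rowSpectralSequence M.cellStructure G R⟩
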